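/- Let $r\ge 2$. An $r$-graph $G$ is a finite $r$-uniform hypergraph; $\delta(G)$ denotes its minimum degree. For a real number $\alpha>1$, the $\alpha$-spectral radius of an $r$-graph $G$ with vertex set $[n]$ is \[ \lambda^{(\alpha)}(G)=\max\Big\{\, r!\sum_{\{i_1,\dots,i_r\}\in E(G)}x_{i_1}\cdots x_{i_r} \;:\; x\in\mathbb{R}^n,\ \big(|x_1|^\alpha+\dots+|x_n|^\alpha\big)^{1/\alpha}=1\Big\}. \] For a family $\mathcal{P}$ of $r$-graphs let $\mathcal{P}_n$ be the set of its $n$-vertex members, and put $\lambda^{(\alpha)}(\mathcal{P},n)=\max_{G\in\mathcal{P}_n}\lambda^{(\alpha)}(G)$ and $\pi(\mathcal{P})=\lim_{n\to\infty}\max_{G\in\mathcal{P}_n}|E(G)|/\binom{n}{r}$. An $r$-pattern $P=([l],E)$ consists of a positive integer $l$ and a set $E$ of $r$-element multisets with elements from $[l]$; an $r$-graph $G$ is $P$-colorable if there is a map $\phi:V(G)\to[l]$ such that the multiset $\{\phi(v_1),\dots,\phi(v_r)\}$ belongs to $E$ for every edge $\{v_1,\dots,v_r\}$ of $G$. $\mathrm{Col}(P)$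 is the family of all $P$-colorable $r$-graphs. For a family $\mathcal{F}$ of $r$-graphs, $G$ is $\mathcal{F}$-free if it contains no member of $\mathcal{F}$ as a (not necessarily induced) subgraph, and $\mathrm{Mon}(\mathcal{F})$ is the family of all $\mathcal{F}$-free $r$-graphs. $\mathcal{F}$ is degree-stable with respect to a family $\mathfrak{H}$ of $\mathcal{F}$-free $r$-graphs if $\pi(\mathrm{Mon}(\mathcal{F}))>0$ and there are $n_0$ and $\varepsilon>0$ such that every $\mathcal{F}$-free $r$-graph $H$ on $n\ge n_0$ vertices with \[ \delta(H)\ \ge\ \Big(\frac{\pi(\mathrm{Mon}(\mathcal{F}))}{(r-1)!}-\varepsilon\Big)n^{r-1} \] belongs to $\mathfrak{H}$. **Theorem.** Let $\alpha>1$ and $r\ge2$, let $P$ be an $r$-pattern, and let $\mathcal{F}$ be a family of $r$-graphs without isolated vertices that is degree-stable with respect to $\mathrm{Col}(P)$. Then for all sufficiently large $n$, every $n$-vertex $\mathcal{F}$-free $r$-graph $G$ satisfies \[ \lambda^{(\alpha)}(G)\le\lambda^{(\alpha)}(\mathrm{Col}(P),n), \] and equality holds only if $G$ is $P$-colorable.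 In particular, $\lambda^{(\alpha)}(\mathrm{Mon}(\mathcal{F}),n)=\lambda^{(\alpha)}(\mathrm{Col}(P),n)$ for all sufficiently large $n$. -/

import Mathlib

open Filter

noncomputable section

/-- An `r`-uniform hypergraph (`r`-graph) with vertex set `V`: a finite set of edges, each of which
is a set of exactly `r` vertices. -/
@[ext]
structure RGraph (r : ℕ) (V : Type*) where
  edges : Finset (Finset V)
  uniform : (edges : Set (Finset V)).Sized r

/-- A family of finite `r`-graphs. Finite `r`-graphs are taken up to isomorphism, with vertex set
`Fin n`; `𝒬 n` is the collection of the members of `𝒬` of order `n`. -/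
abbrev RGraphFamily (r : ℕ) : Type := (n : ℕ) → Set (RGraph r (Fin n))

namespace RGraph

variable {r : ℕ}

/-- `G` contains a copy of `F` as a (not necessarily induced) subgraph. -/
def Contains {V W : Type*} (G : RGraph r V) (F : RGraph r W) : Prop :=
  ∃ f : W ↪ V, ∀ e ∈ F.edges, e.map f ∈ G.edges

/-- `G` is `ℱ`-free: no member of `ℱ` is a subgraph of `G`. -/
def Free {V : Type*} (G : RGraph r V) (ℱ : RGraphFamily r) : Prop :=
  ∀ m, ∀ F ∈ ℱ m, ¬ G.Contains F

/-- The degree of a vertex: the number of edges that contain it. -/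
def degree {V : Type*} [DecidableEq V] (G : RGraph r V) (v : V) : ℕ :=
  (G.edges.filter (fun e => v ∈ e)).card

/-- The minimum degree `δ(G)`. -/
def minDegree {V : Type*} [DecidableEq V] (G : RGraph r V) : ℕ :=
  ⨅ v : V, G.degree v

/-- The Lagrangian polynomial `P_G(x) = r! ∑_{e ∈ E(G)} ∏_{v ∈ e} x_v`. -/
def lagrangianPoly {V : Type*} (G : RGraph r V) (x : V → ℝ) : ℝ :=
  (Nat.factorial r : ℝ) * ∑ e ∈ G.edges, ∏ v ∈ e, x v

/-- The `α`-spectral radius: the maximum of `P_G` over the real vectors `x` (of any signs) with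
`(∑ v, |x v| ^ α) ^ (1 / α) = 1`. For `α ≥ 1` and nonempty `V`, this set of vectors is compact and
nonempty, so the supremum is attained. -/
def spectralRadius {V : Type*} [Fintype V] (α : ℝ) (G : RGraph r V) : ℝ :=
  sSup (G.lagrangianPoly '' {x : V → ℝ | (∑ v, |x v| ^ α) ^ (1 / α) = 1})

end RGraph

/-- An `r`-pattern `P = ([l], E)`: a positive integer `l` and a set `E` of multisets of cardinality
`r` with elements in `[l]`. -/
structure Pattern (r : ℕ) where
  l : ℕ
  l_pos : 0 < l
  edges : Set (Multiset (Fin l))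
  uniform : ∀ s ∈ edges, s.card = r

/-- `G` is `P`-colorable: there is a map `φ : V(G) → [l]` that sends every edge
`{v₁, …, vᵣ}` of `G` to a multiset `{φ v₁, …, φ vᵣ}` in `E`. -/
def RGraph.Colorable {r : ℕ} {V : Type*} (G : RGraph r V) (P : Pattern r) : Prop :=
  ∃ φ : V → Fin P.l, ∀ e ∈ G.edges, e.val.map φ ∈ P.edges

namespace RGraphFamily

variable {r : ℕ}

/-- `Mon(ℱ)`: the family of all `ℱ`-free `r`-graphs. -/
def Mon (ℱ : RGraphFamily r) : RGraphFamily r := fun _ => {G | G.Free ℱ}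

/-- `Col(P)`: the family of all `P`-colorable `r`-graphs. -/
def Col (P : Pattern r) : RGraphFamily r := fun _ => {G | G.Colorable P}

/-- `ex(𝒬, n)`: the maximum number of edges of an `n`-vertex member of `𝒬`. -/
def ex (𝒬 : RGraphFamily r) (n : ℕ) : ℕ :=
  sSup ((fun G : RGraph r (Fin n) => G.edges.card) '' 𝒬 n)

/-- The edge density `π(𝒬) = lim_{n → ∞} ex(𝒬, n) / binom(n, r)`. -/
def edgeDensity (𝒬 : RGraphFamily r) : ℝ :=
  limUnder atTop (fun n : ℕ => (𝒬.ex n : ℝ) / (n.choose r : ℝ))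

/-- `λ^{(α)}(𝒬, n)`: the maximum `α`-spectral radius of an `n`-vertex member of `𝒬` (a maximum over
finitely many `r`-graphs). -/
def spectralEx (α : ℝ) (𝒬 : RGraphFamily r) (n : ℕ) : ℝ :=
  sSup (RGraph.spectralRadius α '' 𝒬 n)

/-- No member of `ℱ` has an isolated vertex. -/
def NoIsolatedVertices (ℱ : RGraphFamily r) : Prop :=
  ∀ m, ∀ F ∈ ℱ m, ∀ v : Fin m, ∃ e ∈ F.edges, v ∈ e

/-- `ℱ` is degree-stable with respect to `ℌ` (for `r ≥ 2`): `π(Mon(ℱ)) > 0`, the members of `ℌ` are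
`ℱ`-free, and there are `n₀` and `ε > 0` such that every `ℱ`-free `r`-graph `G` on `n ≥ n₀` vertices
with `δ(G) ≥ (π(Mon(ℱ)) / (r - 1)! - ε) n ^ (r - 1)` belongs to `ℌ`. -/
structure DegreeStable (ℱ ℌ : RGraphFamily r) : Prop where
  density_pos : 0 < (Mon ℱ).edgeDensity
  free : ∀ n, ℌ n ⊆ Mon ℱ n
  stable : ∃ n₀ : ℕ, ∃ ε : ℝ, 0 < ε ∧ ∀ n ≥ n₀, ∀ G ∈ Mon ℱ n,
    ((Mon ℱ).edgeDensity / (Nat.factorial (r - 1) : ℝ) - ε) * (n : ℝ) ^ (r - 1) ≤ (G.minDegree : ℝ) → G ∈ ℌ n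

end RGraphFamily

end

/-!
Write `c(G) = λ^{(α)}(G) n^{r/α} / (n)_r` for the normalized spectral radius of an `r`-graph `G` of
order `n` (`RGraph.normalizedRadius`), and let `x` be a nonnegative vector of unit `α`-norm that
attains `λ^{(α)}(G)`. The eigenvalue equations for `x` control three operations.

* Deleting a vertex `k` with `x_k ^ α ≤ 1 / n` does not decrease `c`, and multiplies it by at least
  `1 + κ (1 / n - x_k ^ α)`, where `κ = r - max (r / α) 1` is positive because `α > 1`
  (`RGraph.IsMaximizer.normalizedRadius_deleteVertex_ge`).
* Cloning a vertex `k` with `x_k ^ α ≥ 1 / n` multiplies `c` by at least `1 - r ^ 2 / n ^ 2`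
  (`RGraph.exists_cloneVertex_ge`), and it preserves `P`-colorability.
* If every `x_k ^ α` is at least `(1 - η) / n`, then every degree is at least
  `(c(G) / (r - 1)! - o(1)) n ^ (r - 1)` as `η → 0` and `n → ∞` (`RGraph.exists_minDegree_ge`): the
  products of weights over the `(r - 1)`-sets are bounded below, and their sum is bounded above by
  the power mean inequality, so the link of a vertex cannot be heavy without being large.

Let `π` be the edge density of `Mon ℱ`. By the third point and degree-stability, an `ℱ`-free graph
`G` of large order `n` with `c(G) ≥ π` is either `P`-colorable or has a vertex `k` with
`x_k ^ α < (1 - η) / n`, whose deletion multiplies `c` by at least `1 + Θ(1 / n)`. Iterating the deletion, one must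
meet a `P`-colorable graph before the order drops to a fixed bound, since `∏ (1 + Θ(1 / j))`
diverges (`RGraphFamily.exists_descent_mem`). Started at a graph with the most edges, this shows
that the maximum `b_n` of `c` over the `P`-colorable graphs of order `n` is at least `π`
(`RGraphFamily.DegreeStable.edgeDensity_le_normalizedEx`). Started at an `ℱ`-free graph `G` with
`c(G) ≥ b_n` that is not `P`-colorable, it gives some `m < n` with
`b_m ≥ b_n ∏_{m ≤ j < n} (1 + Θ(1 / j))`. By cloning, `b_n ≥ b_m ∏_{m ≤ j < n} (1 - r ^ 2 / j ^ 2)`,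
and the two bounds contradict each other
(`RGraphFamily.DegreeStable.colorable_of_spectralEx_le`).
-/

/-! ### Pullbacks, deletion and cloning of vertices -/

namespace RGraph

variable {r : ℕ} {V W : Type*}

/-- The pullback of an `r`-graph `G` along a map `ψ` of vertex sets: an `r`-set is an edge if `ψ`
maps it bijectively onto an edge of `G`. For injective `ψ` this is an induced subgraph of `G`, for
surjective `ψ` it is a blow-up of `G`. -/
def pullback [Fintype V] [DecidableEq V] [DecidableEq W] (G : RGraph r W) (ψ : V → W) :
    RGraph r V where
  edges := Finset.univ.filter (fun e => e.card = r ∧ e.image ψ ∈ G.edges)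
  uniform := by
    intro e he
    simp only [Finset.coe_filter, Set.mem_ofPred_eq] at he
    exact he.2.1

theorem card_of_mem_edges (G : RGraph r V) {e : Finset V} (he : e ∈ G.edges) : e.card = r :=
  G.uniform he

theorem mem_pullback [Fintype V] [DecidableEq V] [DecidableEq W] {G : RGraph r W} {ψ : V → W}
    {e : Finset V} : e ∈ (G.pullback ψ).edges ↔ e.card = r ∧ e.image ψ ∈ G.edges := by
  simp [pullback]

theorem injOn_of_mem_pullback [Fintype V] [DecidableEq V] [DecidableEq W] {G : RGraph r W}
    {ψ : V → W} {e : Finset V} (he : e ∈ (G.pullback ψ).edges) : Set.InjOn ψ e := by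
  rw [mem_pullback] at he
  rw [← Finset.card_image_iff, he.1, G.card_of_mem_edges he.2]

theorem mem_pullback_of_injective [Fintype V] [DecidableEq V] [DecidableEq W] {G : RGraph r W}
    {ψ : V → W} (hψ : ψ.Injective) {e : Finset V} :
    e ∈ (G.pullback ψ).edges ↔ e.image ψ ∈ G.edges := by
  rw [mem_pullback, and_iff_right_iff_imp]
  intro h
  rw [← G.card_of_mem_edges h, Finset.card_image_of_injective _ hψ]

theorem pullback_pullback_of_comp_eq_id [Fintype V] [DecidableEq V] [Fintype W] [DecidableEq W]
    (G : RGraph r W) (ψ : V → W) (χ : W → V) (h : ψ ∘ χ = id) :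
    (G.pullback ψ).pullback χ = G := by
  have hχ : χ.Injective := fun a b hab => by
    simpa [hab, eq_comm] using (congrFun h a).symm.trans ((congrArg ψ hab).trans (congrFun h b))
  ext e
  rw [mem_pullback_of_injective hχ, mem_pullback, Finset.image_image, h, Finset.image_id,
    Finset.card_image_of_injective _ hχ, and_iff_right_iff_imp]
  exact fun he => G.card_of_mem_edges he

theorem Colorable.pullback [Fintype V] [DecidableEq V] [DecidableEq W] {G : RGraph r W}
    {P : Pattern r} (h : G.Colorable P) (ψ : V → W) : (G.pullback ψ).Colorable P := by
  obtain ⟨φ, hφ⟩ := h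
  refine ⟨φ ∘ ψ, fun e he => ?_⟩
  have := hφ _ (mem_pullback.1 he).2
  rwa [Finset.image_val_of_injOn (injOn_of_mem_pullback he), Multiset.map_map] at this

theorem Free.pullback [Fintype V] [DecidableEq V] [DecidableEq W] {G : RGraph r W}
    {ℱ : RGraphFamily r} (h : G.Free ℱ) (ψ : V ↪ W) : (G.pullback ψ).Free ℱ := by
  rintro m F hF ⟨f, hf⟩
  refine h m F hF ⟨f.trans ψ, fun e he => ?_⟩
  have := (mem_pullback.1 (hf e he)).2
  rwa [← Finset.map_eq_image, Finset.map_map] at this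

instance [Finite V] : Finite (RGraph r V) :=
  Finite.of_injective (fun G : RGraph r V => G.edges) (fun _ _ h => RGraph.ext h)

/-- The partial derivative of the Lagrangian polynomial with respect to the weight of `k`. -/
noncomputable def linkPoly [DecidableEq V] (G : RGraph r V) (k : V) (x : V → ℝ) : ℝ :=
  (Nat.factorial r : ℝ) * ∑ e ∈ G.edges with k ∈ e, ∏ v ∈ e.erase k, x v

/-- Deletion of the vertex `k`, with the remaining vertices relabelled in order. -/
def deleteVertex {n : ℕ} (G : RGraph r (Fin (n + 1))) (k : Fin (n + 1)) : RGraph r (Fin n) :=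
  G.pullback k.succAbove

/-- Addition of a twin of the vertex `k`, as the new last vertex. No edge contains both twins. -/
def cloneVertex {n : ℕ} (G : RGraph r (Fin n)) (k : Fin n) : RGraph r (Fin (n + 1)) :=
  G.pullback (Fin.snoc (α := fun _ => Fin n) id k)

theorem map_succAbove_mem_iff {n : ℕ} (G : RGraph r (Fin (n + 1))) (k : Fin (n + 1))
    (e : Finset (Fin n)) :
    e ∈ (G.deleteVertex k).edges ↔ e.map k.succAboveEmb ∈ G.edges := by
  rw [deleteVertex, mem_pullback_of_injective Fin.succAbove_right_injective, Finset.map_eq_image]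
  rfl

theorem exists_map_succAbove {n : ℕ} (k : Fin (n + 1)) (e : Finset (Fin (n + 1))) (hk : k ∉ e) :
    ∃ f : Finset (Fin n), f.map k.succAboveEmb = e := by
  refine ⟨Finset.univ.filter fun i => k.succAbove i ∈ e, ?_⟩
  ext v
  simp only [Finset.mem_map, Finset.mem_filter, Finset.mem_univ, true_and]
  constructor
  · rintro ⟨i, hi, rfl⟩; exact hi
  · intro hv
    obtain ⟨i, rfl⟩ := Fin.exists_succAbove_eq (x := v) (y := k) (by rintro rfl; exact hk hv)
    exact ⟨i, hv, rfl⟩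

theorem edges_deleteVertex {n : ℕ} (G : RGraph r (Fin (n + 1))) (k : Fin (n + 1)) :
    (G.deleteVertex k).edges.map (Finset.mapEmbedding k.succAboveEmb).toEmbedding =
      G.edges.filter (fun e => k ∉ e) := by
  ext e
  simp only [Finset.mem_map, Finset.mem_filter, map_succAbove_mem_iff]
  constructor
  · rintro ⟨f, hf, rfl⟩
    refine ⟨hf, ?_⟩
    simp [Finset.mapEmbedding, Fin.succAbove_ne]
  · rintro ⟨he, hk⟩
    obtain ⟨f, rfl⟩ := exists_map_succAbove k e hk
    exact ⟨f, he, rfl⟩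

theorem lagrangianPoly_eq_deleteVertex_add {n : ℕ} (G : RGraph r (Fin (n + 1)))
    (k : Fin (n + 1)) (x : Fin (n + 1) → ℝ) :
    G.lagrangianPoly x =
      (G.deleteVertex k).lagrangianPoly (x ∘ k.succAbove) + x k * G.linkPoly k x := by
  have h1 : ∑ e ∈ (G.deleteVertex k).edges, ∏ v ∈ e, (x ∘ k.succAbove) v =
      ∑ e ∈ G.edges with k ∉ e, ∏ v ∈ e, x v := by
    rw [← edges_deleteVertex, Finset.sum_map]
    refine Finset.sum_congr rfl fun e _ => ?_
    simp [Finset.mapEmbedding]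
  have h2 : x k * ∑ e ∈ G.edges with k ∈ e, ∏ v ∈ e.erase k, x v =
      ∑ e ∈ G.edges with k ∈ e, ∏ v ∈ e, x v := by
    rw [Finset.mul_sum]
    refine Finset.sum_congr rfl fun e he => ?_
    exact Finset.mul_prod_erase _ _ (Finset.mem_filter.1 he).2
  rw [lagrangianPoly, lagrangianPoly, linkPoly, mul_left_comm, h1, h2, ← mul_add,
    Finset.sum_filter_not_add_sum_filter]

theorem card_edges_eq_deleteVertex_add_degree {n : ℕ} (G : RGraph r (Fin (n + 1)))
    (k : Fin (n + 1)) : G.edges.card = (G.deleteVertex k).edges.card + G.degree k := by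
  rw [← Finset.card_map (Finset.mapEmbedding k.succAboveEmb).toEmbedding, edges_deleteVertex,
    degree, Nat.add_comm (Finset.card _), Finset.card_filter_add_card_filter_not]

theorem linkPoly_update [DecidableEq V] (G : RGraph r V) (k : V) (x : V → ℝ) (t : ℝ) :
    G.linkPoly k (Function.update x k t) = G.linkPoly k x := by
  unfold linkPoly
  congr 1
  refine Finset.sum_congr rfl fun e _ => Finset.prod_congr rfl fun v hv => ?_
  rw [Function.update_of_ne (Finset.ne_of_mem_erase hv)]

theorem deleteVertex_cloneVertex {n : ℕ} (G : RGraph r (Fin n)) (k : Fin n) :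
    (G.cloneVertex k).deleteVertex (Fin.last n) = G := by
  apply pullback_pullback_of_comp_eq_id
  rw [Fin.succAbove_last]
  ext i
  simp

theorem linkPoly_cloneVertex {n : ℕ} (G : RGraph r (Fin n)) (k : Fin n) (x : Fin n → ℝ) (t : ℝ) :
    (G.cloneVertex k).linkPoly (Fin.last n) (Fin.snoc (α := fun _ => ℝ) x t) = G.linkPoly k x := by
  set ψ : Fin (n + 1) → Fin n := Fin.snoc (α := fun _ => Fin n) id k with hψ
  have hlast : ψ (Fin.last n) = k := by simp [hψ]
  have hcast : ∀ i : Fin n, ψ i.castSucc = i := by simp [hψ]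
  unfold linkPoly
  congr 1
  refine Finset.sum_bij' (fun e _ => e.image ψ)
    (fun f _ => insert (Fin.last n) ((f.erase k).map Fin.castSuccEmb)) ?_ ?_ ?_ ?_ ?_
  · intro e he
    rw [Finset.mem_filter] at he ⊢
    exact ⟨(mem_pullback.1 he.1).2, Finset.mem_image.2 ⟨_, he.2, hlast⟩⟩
  · intro f hf
    rw [Finset.mem_filter] at hf ⊢
    refine ⟨mem_pullback.2 ⟨?_, ?_⟩, Finset.mem_insert_self _ _⟩
    · rw [Finset.card_insert_of_notMem (by simp [Fin.castSucc_ne_last]), Finset.card_map,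
        Finset.card_erase_add_one hf.2, G.card_of_mem_edges hf.1]
    · have : (insert (Fin.last n) ((f.erase k).map Fin.castSuccEmb)).image ψ = f := by
        rw [Finset.image_insert, hlast, Finset.map_eq_image, Finset.image_image]
        have : ψ ∘ ⇑(Fin.castSuccEmb (n := n)) = id := funext fun i => hcast i
        rw [this, Finset.image_id, Finset.insert_erase hf.2]
      rw [← hψ, this]
      exact hf.1
  · intro e he
    rw [Finset.mem_filter] at he
    have hinj := injOn_of_mem_pullback he.1
    rw [← hψ] at hinj
    ext v
    induction v using Fin.lastCases with
    | last => simp [he.2]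
    | cast i =>
      simp only [Finset.mem_insert, Finset.mem_map, Finset.mem_erase, Finset.mem_image,
        Fin.castSucc_ne_last, false_or]
      constructor
      · rintro ⟨j, ⟨hjk, v, hv, hvj⟩, hji⟩
        have hji : j = i := Fin.castSucc_injective _ hji
        induction v using Fin.lastCases with
        | last => exact absurd (hvj.symm.trans hlast) hjk
        | cast w =>
          rw [hcast] at hvj
          rwa [← hji, ← hvj]
      · intro hi
        refine ⟨i, ⟨?_, _, hi, hcast i⟩, rfl⟩
        rintro rfl
        exact Fin.castSucc_ne_last i (hinj hi he.2 ((hcast i).trans hlast.symm))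
  · intro f hf
    rw [Finset.mem_filter] at hf
    rw [Finset.image_insert, hlast, Finset.map_eq_image, Finset.image_image]
    have : ψ ∘ ⇑(Fin.castSuccEmb (n := n)) = id := funext fun i => hcast i
    rw [this, Finset.image_id, Finset.insert_erase hf.2]
  · intro e he
    rw [Finset.mem_filter] at he
    have hinj := injOn_of_mem_pullback he.1
    rw [← hψ] at hinj
    have himg : (e.image ψ).erase k = (e.erase (Fin.last n)).image ψ := by
      ext v
      simp only [Finset.mem_erase, Finset.mem_image]
      constructor
      · rintro ⟨hv, w, hw, rfl⟩
        exact ⟨w, ⟨fun h => hv (h ▸ hlast), hw⟩, rfl⟩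
      · rintro ⟨w, ⟨hw, hwe⟩, rfl⟩
        exact ⟨fun h => hw (hinj hwe he.2 (h.trans hlast.symm)), w, hwe, rfl⟩
    rw [himg, Finset.prod_image]
    · refine Finset.prod_congr rfl fun v hv => ?_
      induction v using Fin.lastCases with
      | last => exact absurd rfl (Finset.ne_of_mem_erase hv)
      | cast i => rw [hcast, Fin.snoc_castSucc]
    · exact hinj.mono (by intro v hv; exact Finset.mem_of_mem_erase hv)

theorem lagrangianPoly_cloneVertex {n : ℕ} (G : RGraph r (Fin n)) (k : Fin n) (x : Fin n → ℝ)
    (t : ℝ) :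
    (G.cloneVertex k).lagrangianPoly (Fin.snoc (α := fun _ => ℝ) x t) =
      G.lagrangianPoly x + t * G.linkPoly k x := by
  rw [lagrangianPoly_eq_deleteVertex_add _ (Fin.last n), linkPoly_cloneVertex,
    deleteVertex_cloneVertex, Fin.snoc_last]
  congr 2
  ext i
  simp [Fin.succAbove_last]

end RGraph

/-! ### Maximizers of the Lagrangian polynomial and the eigenvalue equations -/

namespace RGraph

variable {r : ℕ} {V : Type*}

theorem lagrangianPoly_nonneg (G : RGraph r V) {x : V → ℝ} (hx : ∀ v, 0 ≤ x v) :
    0 ≤ G.lagrangianPoly x :=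
  mul_nonneg (Nat.cast_nonneg _)
    (Finset.sum_nonneg fun _ _ => Finset.prod_nonneg fun v _ => hx v)

theorem lagrangianPoly_le_abs (G : RGraph r V) (x : V → ℝ) :
    G.lagrangianPoly x ≤ G.lagrangianPoly fun v => |x v| := by
  refine mul_le_mul_of_nonneg_left (Finset.sum_le_sum fun e _ => ?_) (Nat.cast_nonneg _)
  rw [← Finset.abs_prod]
  exact le_abs_self _

theorem lagrangianPoly_const_mul (G : RGraph r V) (c : ℝ) (x : V → ℝ) :
    (G.lagrangianPoly fun v => c * x v) = c ^ r * G.lagrangianPoly x := by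
  unfold lagrangianPoly
  rw [mul_left_comm, Finset.mul_sum G.edges _ (c ^ r)]
  congr 1
  refine Finset.sum_congr rfl fun e he => ?_
  rw [Finset.prod_mul_distrib, Finset.prod_const, G.card_of_mem_edges he]

theorem lagrangianPoly_const (G : RGraph r V) (c : ℝ) :
    (G.lagrangianPoly fun _ => c) = (Nat.factorial r : ℝ) * G.edges.card * c ^ r := by
  have := G.lagrangianPoly_const_mul c fun _ => 1
  simp only [mul_one] at this
  rw [this, mul_comm]
  simp [lagrangianPoly]

theorem lagrangianPoly_zero (hr : r ≠ 0) (G : RGraph r V) :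
    (G.lagrangianPoly fun _ => 0) = 0 := by
  rw [lagrangianPoly_const, zero_pow hr, mul_zero]

theorem continuous_lagrangianPoly (G : RGraph r V) : Continuous G.lagrangianPoly := by
  unfold lagrangianPoly
  fun_prop

variable [Fintype V] {α : ℝ}

theorem rpow_one_div_eq_one_iff {α S : ℝ} (hα : 0 < α) (hS : 0 ≤ S) :
    S ^ (1 / α) = 1 ↔ S = 1 := by
  rw [one_div, Real.rpow_inv_eq hS zero_le_one hα.ne', Real.one_rpow]

theorem isCompact_sphere (hα : 0 < α) :
    IsCompact {x : V → ℝ | (∑ v, |x v| ^ α) ^ (1 / α) = 1} := by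
  refine Metric.isCompact_of_isClosed_isBounded ?_ ?_
  · refine isClosed_eq ?_ continuous_const
    refine Continuous.rpow_const ?_ fun _ => Or.inr (by positivity)
    refine continuous_finsetSum _ fun v _ => ?_
    exact Continuous.rpow_const (by fun_prop) fun _ => Or.inr hα.le
  · refine (Metric.isBounded_closedBall (x := (0 : V → ℝ)) (r := 1)).subset fun x hx => ?_
    rw [mem_closedBall_zero_iff, pi_norm_le_iff_of_nonneg zero_le_one]
    intro v
    have h0 : 0 ≤ ∑ v, |x v| ^ α := Finset.sum_nonneg fun _ _ => by positivity
    have h1 : ∑ v, |x v| ^ α = 1 := by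
      have h : (∑ v, |x v| ^ α) ^ (1 / α) = 1 := hx
      rwa [rpow_one_div_eq_one_iff hα h0] at h
    have h2 : |x v| ^ α ≤ 1 :=
      h1 ▸ Finset.single_le_sum (f := fun v => |x v| ^ α) (fun _ _ => by positivity)
        (Finset.mem_univ v)
    rw [Real.norm_eq_abs]
    rwa [← Real.rpow_le_rpow_iff (abs_nonneg _) zero_le_one hα, Real.one_rpow]

/-- A nonnegative vector of unit `α`-norm at which the Lagrangian polynomial attains the
`α`-spectral radius. -/
structure IsMaximizer (G : RGraph r V) (α : ℝ) (x : V → ℝ) : Prop where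
  nonneg : ∀ v, 0 ≤ x v
  sum_eq : ∑ v, x v ^ α = 1
  eq : G.lagrangianPoly x = G.spectralRadius α

theorem mem_sphere_iff (hα : 0 < α) {x : V → ℝ} (hx : ∀ v, 0 ≤ x v) :
    x ∈ {x : V → ℝ | (∑ v, |x v| ^ α) ^ (1 / α) = 1} ↔ ∑ v, x v ^ α = 1 := by
  have h0 : 0 ≤ ∑ v, |x v| ^ α := Finset.sum_nonneg fun _ _ => by positivity
  rw [Set.mem_ofPred_eq, rpow_one_div_eq_one_iff hα h0]
  simp [abs_of_nonneg (hx _)]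

theorem bddAbove_lagrangianPoly_image (hα : 0 < α) (G : RGraph r V) :
    BddAbove (G.lagrangianPoly '' {x : V → ℝ | (∑ v, |x v| ^ α) ^ (1 / α) = 1}) :=
  ((isCompact_sphere hα).image G.continuous_lagrangianPoly).bddAbove

theorem lagrangianPoly_le_spectralRadius (hα : 0 < α) (G : RGraph r V) {x : V → ℝ}
    (hx : ∀ v, 0 ≤ x v) (h : ∑ v, x v ^ α = 1) : G.lagrangianPoly x ≤ G.spectralRadius α :=
  le_csSup (bddAbove_lagrangianPoly_image hα G) ⟨x, (mem_sphere_iff hα hx).2 h, rfl⟩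

theorem exists_isMaximizer [Nonempty V] (hα : 0 < α) (G : RGraph r V) :
    ∃ x, G.IsMaximizer α x := by
  classical
  have hne : ({x : V → ℝ | (∑ v, |x v| ^ α) ^ (1 / α) = 1}).Nonempty := by
    obtain ⟨w⟩ := ‹Nonempty V›
    refine ⟨Pi.single w 1, (mem_sphere_iff hα fun v => ?_).2 ?_⟩
    · by_cases h : v = w
      · subst h; simp
      · simp [h]
    · rw [Finset.sum_eq_single w]
      · simp
      · intro v _ hv
        simp [hv, hα.ne']
      · simp
  have hcpt := (isCompact_sphere (V := V) hα).image G.continuous_lagrangianPoly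
  obtain ⟨x, hx, hxG⟩ := hcpt.sSup_mem (hne.image _)
  have hx' : ∑ v, |x v| ^ α = 1 := by
    have h0 : 0 ≤ ∑ v, |x v| ^ α := Finset.sum_nonneg fun _ _ => by positivity
    have h : (∑ v, |x v| ^ α) ^ (1 / α) = 1 := hx
    rwa [rpow_one_div_eq_one_iff hα h0] at h
  refine ⟨fun v => |x v|, fun v => abs_nonneg _, hx', le_antisymm ?_ ?_⟩
  · exact lagrangianPoly_le_spectralRadius hα G (fun v => abs_nonneg _) hx'
  · exact hxG.symm.le.trans (G.lagrangianPoly_le_abs x)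

theorem spectralRadius_nonneg [Nonempty V] (hα : 0 < α) (G : RGraph r V) :
    0 ≤ G.spectralRadius α := by
  obtain ⟨x, hx⟩ := G.exists_isMaximizer hα
  exact hx.eq ▸ G.lagrangianPoly_nonneg hx.nonneg

/-- The homogeneous form of the definition of the `α`-spectral radius. -/
theorem lagrangianPoly_le (hr : r ≠ 0) (hα : 0 < α) (G : RGraph r V) {y : V → ℝ}
    (hy : ∀ v, 0 ≤ y v) :
    G.lagrangianPoly y ≤ G.spectralRadius α * (∑ v, y v ^ α) ^ ((r : ℝ) / α) := by
  have hS : 0 ≤ ∑ v, y v ^ α := Finset.sum_nonneg fun v _ => Real.rpow_nonneg (hy v) _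
  have hrα : (r : ℝ) / α ≠ 0 := by
    have : (r : ℝ) ≠ 0 := by exact_mod_cast hr
    positivity
  rcases hS.eq_or_lt with hS | hS
  · have h0 : y = fun _ => 0 := by
      ext v
      have := (Finset.sum_eq_zero_iff_of_nonneg
        (fun v _ => Real.rpow_nonneg (hy v) α)).1 hS.symm v (Finset.mem_univ v)
      exact (Real.rpow_eq_zero (hy v) hα.ne').1 this
    rw [← hS, Real.zero_rpow hrα, mul_zero, h0, lagrangianPoly_zero hr]
  · set S := ∑ v, y v ^ α
    have hc : 0 < S ^ (1 / α) := Real.rpow_pos_of_pos hS _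
    have hcr : (S ^ (1 / α)) ^ r = S ^ ((r : ℝ) / α) := by
      rw [← Real.rpow_natCast, ← Real.rpow_mul hS.le]
      congr 1
      ring
    have hle := lagrangianPoly_le_spectralRadius hα G (x := fun v => (S ^ (1 / α))⁻¹ * y v)
      (fun v => mul_nonneg (inv_nonneg.2 hc.le) (hy v)) (by
        have : ∀ v, ((S ^ (1 / α))⁻¹ * y v) ^ α = S⁻¹ * y v ^ α := fun v => by
          rw [Real.mul_rpow (inv_nonneg.2 hc.le) (hy v), Real.inv_rpow hc.le,
            ← Real.rpow_mul hS.le, one_div_mul_cancel hα.ne', Real.rpow_one]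
        simp_rw [this]
        rw [← Finset.mul_sum]
        exact inv_mul_cancel₀ hS.ne')
    rw [lagrangianPoly_const_mul, inv_pow, hcr,
      inv_mul_le_iff₀ (Real.rpow_pos_of_pos hS _)] at hle
    rwa [mul_comm]

theorem lagrangianPoly_update {n : ℕ} (G : RGraph r (Fin n)) (k : Fin n) (x : Fin n → ℝ) (t : ℝ) :
    G.lagrangianPoly (Function.update x k t) = G.lagrangianPoly x + (t - x k) * G.linkPoly k x := by
  obtain _ | n := n
  · exact k.elim0
  · rw [lagrangianPoly_eq_deleteVertex_add _ k, lagrangianPoly_eq_deleteVertex_add G k x,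
      linkPoly_update, Function.update_self]
    have : Function.update x k t ∘ k.succAbove = x ∘ k.succAbove := by
      ext i
      simp [Fin.succAbove_ne]
    rw [this]
    ring

/-- The eigenvalue equations at the coordinates in the support of a maximizer. -/
theorem IsMaximizer.linkPoly_eq {n : ℕ} {G : RGraph r (Fin n)} {x : Fin n → ℝ} (hr : r ≠ 0)
    (hα : 0 < α) (h : G.IsMaximizer α x) {k : Fin n} (hk : 0 < x k) :
    G.linkPoly k x = r * G.spectralRadius α * x k ^ (α - 1) := by
  set l := G.spectralRadius α
  set p := (r : ℝ) / α with hp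
  set F : ℝ → ℝ := fun t => l * (1 - x k ^ α + t ^ α) ^ p - (t - x k) * G.linkPoly k x
  have hsum : ∀ t, ∑ v, Function.update x k t v ^ α = 1 - x k ^ α + t ^ α := fun t => by
    rw [← h.sum_eq, ← Finset.add_sum_erase _ _ (Finset.mem_univ k),
      ← Finset.add_sum_erase Finset.univ (fun v => x v ^ α) (Finset.mem_univ k),
      Function.update_self]
    rw [Finset.sum_congr rfl fun v hv => by rw [Function.update_of_ne (Finset.ne_of_mem_erase hv)]]
    ring
  have hF : ∀ t, 0 ≤ t → l ≤ F t := fun t ht => by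
    have := G.lagrangianPoly_le (α := α) hr hα (y := Function.update x k t) (fun v => by
      by_cases hv : v = k
      · subst hv; simpa using ht
      · simpa [hv] using h.nonneg v)
    rw [hsum, lagrangianPoly_update, h.eq] at this
    simp only [F]
    linarith
  have hFx : F (x k) = l := by simp [F]
  have hmin : IsLocalMin F (x k) := by
    filter_upwards [lt_mem_nhds hk] with t ht
    rw [hFx]
    exact hF t ht.le
  have hder : HasDerivAt F
      (l * ((α * x k ^ (α - 1)) * p * (1 - x k ^ α + x k ^ α) ^ (p - 1)) - 1 * G.linkPoly k x)
      (x k) := by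
    refine HasDerivAt.sub ?_ (((hasDerivAt_id _).sub_const _).mul_const _)
    refine HasDerivAt.const_mul _ ?_
    refine HasDerivAt.rpow_const ?_ (Or.inl (by simp))
    exact (Real.hasDerivAt_rpow_const (Or.inl hk.ne')).const_add _
  have := hmin.hasDerivAt_eq_zero hder
  rw [sub_add_cancel, Real.one_rpow, mul_one, one_mul] at this
  have hpα : α * p = r := by rw [hp]; field_simp
  linear_combination -this + l * x k ^ (α - 1) * hpα

theorem IsMaximizer.mul_linkPoly_eq {n : ℕ} {G : RGraph r (Fin n)} {x : Fin n → ℝ} (hr : r ≠ 0)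
    (hα : 0 < α) (h : G.IsMaximizer α x) (k : Fin n) :
    x k * G.linkPoly k x = r * G.spectralRadius α * x k ^ α := by
  rcases (h.nonneg k).eq_or_lt with hk | hk
  · rw [← hk, Real.zero_rpow hα.ne', zero_mul, mul_zero]
  · rw [h.linkPoly_eq hr hα hk, Real.rpow_sub_one hk.ne']
    field_simp

/-- Deleting a vertex from a graph with maximizer `x` leaves the rest of the maximizer as a test
vector. -/
theorem IsMaximizer.spectralRadius_deleteVertex_ge {n : ℕ} {G : RGraph r (Fin (n + 1))}
    {x : Fin (n + 1) → ℝ} (hr : r ≠ 0) (hα : 0 < α) (h : G.IsMaximizer α x) (k : Fin (n + 1)) :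
    G.spectralRadius α * (1 - r * x k ^ α) ≤
      (G.deleteVertex k).spectralRadius α * (1 - x k ^ α) ^ ((r : ℝ) / α) := by
  have h1 := (G.deleteVertex k).lagrangianPoly_le hr hα (y := x ∘ k.succAbove)
    fun v => h.nonneg _
  have h2 : ∑ v, (x ∘ k.succAbove) v ^ α = 1 - x k ^ α := by
    rw [← h.sum_eq, Fin.sum_univ_succAbove _ k]
    simp
  have h3 := G.lagrangianPoly_eq_deleteVertex_add k x
  rw [h.eq, h.mul_linkPoly_eq hr hα] at h3
  rw [h2] at h1
  linarith

/-- Giving the twin of `k` the weight `t * x k` makes an optimal vector of `G` into a test vector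
of the clone. -/
theorem IsMaximizer.spectralRadius_cloneVertex_ge {n : ℕ} {G : RGraph r (Fin n)}
    {x : Fin n → ℝ} (hr : r ≠ 0) (hα : 0 < α) (h : G.IsMaximizer α x) (k : Fin n) {t : ℝ}
    (ht : 0 ≤ t) :
    G.spectralRadius α * (1 + r * (t * x k ^ α)) ≤
      (G.cloneVertex k).spectralRadius α * (1 + t ^ α * x k ^ α) ^ ((r : ℝ) / α) := by
  have h1 := (G.cloneVertex k).lagrangianPoly_le hr hα
    (y := Fin.snoc (α := fun _ => ℝ) x (t * x k)) (fun v => by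
      induction v using Fin.lastCases with
      | last => simpa using mul_nonneg ht (h.nonneg k)
      | cast i => simpa using h.nonneg i)
  rw [lagrangianPoly_cloneVertex, h.eq, mul_assoc, h.mul_linkPoly_eq hr hα,
    Fin.sum_univ_castSucc] at h1
  simp only [Fin.snoc_castSucc, Fin.snoc_last] at h1
  rw [h.sum_eq, Real.mul_rpow ht (h.nonneg k)] at h1
  linarith

end RGraph

/-! ### Real inequalities -/

theorem one_sub_max_mul_le_rpow {p w : ℝ} (hw0 : 0 ≤ w) (hw1 : w ≤ 1) :
    1 - max p 1 * w ≤ (1 - w) ^ p := by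
  rcases hw1.eq_or_lt with rfl | hw
  · have : (1 : ℝ) ≤ max p 1 := le_max_right _ _
    have : (0 : ℝ) ≤ (1 - 1) ^ p := Real.rpow_nonneg (by norm_num) _
    linarith
  calc 1 - max p 1 * w = 1 + max p 1 * -w := by ring
    _ ≤ (1 + -w) ^ max p 1 :=
        one_add_mul_self_le_rpow_one_add (by linarith) (le_max_right _ _)
    _ ≤ (1 + -w) ^ p :=
        Real.rpow_le_rpow_of_exponent_ge (by linarith) (by linarith) (le_max_left _ _)
    _ = (1 - w) ^ p := by rw [sub_eq_add_neg]

/-- The analytic inequality behind vertex deletion: the loss caused by removing a weight `s`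
below the average weight `u` is smaller than the loss at `s = u`, by an amount linear in
`u - s`. -/
theorem deletion_inequality {p q s u : ℝ} (hs : 0 ≤ s) (hsu : s ≤ u) (hu : u < 1)
    (hqu : q * u ≤ 1) (hq : max p 1 ≤ q) :
    (1 - s) ^ p * ((1 - q * u) + (q - max p 1) * (u - s)) ≤ (1 - q * s) * (1 - u) ^ p := by
  have hs1 : 0 < 1 - s := by linarith
  have hq1 : (1 : ℝ) ≤ max p 1 := le_max_right _ _
  set w := (u - s) / (1 - s) with hw
  have hws : w * (1 - s) = u - s := div_mul_cancel₀ _ hs1.ne'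
  have hw0 : 0 ≤ w := div_nonneg (by linarith) hs1.le
  have hw1 : w ≤ 1 := (div_le_one hs1).2 (by linarith)
  have hwu : u - s ≤ w := le_div_self (by linarith) hs1 (by linarith)
  have hsplit : 1 - u = (1 - s) * (1 - w) := by linarith
  have hqs : 0 ≤ 1 - q * s := by nlinarith
  rw [hsplit, Real.mul_rpow hs1.le (by linarith), mul_left_comm]
  refine mul_le_mul_of_nonneg_left ?_ (Real.rpow_nonneg hs1.le _)
  refine le_trans ?_ (mul_le_mul_of_nonneg_left (one_sub_max_mul_le_rpow hw0 hw1) hqs)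
  -- The difference of the two sides is a sum of two nonnegative terms.
  have h1 : 0 ≤ (q - max p 1) * (w - (u - s)) :=
    mul_nonneg (by linarith) (by linarith)
  have h2 : 0 ≤ q * s * w * (max p 1 - 1) :=
    mul_nonneg (mul_nonneg (mul_nonneg (by linarith) hs) hw0) (by linarith)
  have : (1 - q * s) * (1 - max p 1 * w) - ((1 - q * u) + (q - max p 1) * (u - s)) =
      (q - max p 1) * (w - (u - s)) + q * s * w * (max p 1 - 1) := by
    linear_combination (-q) * hws
  linarith

/-- The elementary symmetric polynomials of nonnegative reals satisfy `k! * e_k ≤ e_1 ^ k`. -/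
theorem factorial_mul_sum_powersetCard_prod_le {ι : Type*} [DecidableEq ι] (s : Finset ι)
    {x : ι → ℝ} (hx : ∀ i, 0 ≤ x i) (k : ℕ) :
    (Nat.factorial k : ℝ) * ∑ f ∈ s.powersetCard k, ∏ i ∈ f, x i ≤ (∑ i ∈ s, x i) ^ k := by
  induction s using Finset.induction_on generalizing k with
  | empty =>
    cases k with
    | zero => simp
    | succ k =>
      rw [Finset.powersetCard_eq_empty.2 (by simp)]
      simp
  | insert a s ha ih =>
    cases k with
    | zero => simp
    | succ k =>
      have hdisj : Disjoint (s.powersetCard (k + 1)) ((s.powersetCard k).image (insert a)) := by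
        rw [Finset.disjoint_left]
        intro f hf hf'
        obtain ⟨g, _, rfl⟩ := Finset.mem_image.1 hf'
        exact ha ((Finset.mem_powersetCard.1 hf).1 (Finset.mem_insert_self _ _))
      have hnot : ∀ f ∈ s.powersetCard k, a ∉ f := fun f hf haf =>
        ha ((Finset.mem_powersetCard.1 hf).1 haf)
      have himg : ∑ f ∈ (s.powersetCard k).image (insert a), ∏ i ∈ f, x i =
          x a * ∑ f ∈ s.powersetCard k, ∏ i ∈ f, x i := by
        rw [Finset.sum_image, Finset.mul_sum]
        · exact Finset.sum_congr rfl fun f hf => Finset.prod_insert (hnot f hf)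
        · intro f hf g hg hfg
          rw [← Finset.erase_insert (hnot f hf), ← Finset.erase_insert (hnot g hg), hfg]
      rw [Finset.powersetCard_succ_insert ha, Finset.sum_union hdisj, himg, Finset.sum_insert ha]
      set S := ∑ i ∈ s, x i
      have hS : 0 ≤ S := Finset.sum_nonneg fun i _ => hx i
      have h1 := ih (k + 1)
      have h2 := mul_le_mul_of_nonneg_left (ih k)
        (mul_nonneg (Nat.cast_nonneg (α := ℝ) (k + 1)) (hx a))
      have h3 : S ^ (k + 1) + (k + 1 : ℕ) * (x a * S ^ k) ≤ (x a + S) ^ (k + 1) := by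
        rw [add_comm (x a), add_pow]
        rw [Finset.sum_range_succ, Finset.sum_range_succ]
        have : 0 ≤ ∑ m ∈ Finset.range k,
            S ^ m * x a ^ (k + 1 - m) * ((k + 1).choose m : ℝ) :=
          Finset.sum_nonneg fun m _ => by have := hx a; positivity
        simp only [Nat.add_sub_cancel_left, Nat.sub_self, pow_one, pow_zero, Nat.choose_self,
          Nat.choose_succ_self_right, Nat.cast_one, mul_one]
        linarith
      rw [Nat.factorial_succ] at h1 ⊢
      push_cast at *
      linarith

/-! ### The normalized spectral radius under deletion and cloning -/

namespace RGraph

variable {r n : ℕ} {α : ℝ}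

/-- The `α`-spectral radius of an `r`-graph of order `n`, divided by the value
`n (n - 1) ⋯ (n - r + 1) / n ^ (r / α)` that the constant unit vector gives for the complete
`r`-graph. -/
noncomputable def normalizedRadius (α : ℝ) (G : RGraph r (Fin n)) : ℝ :=
  G.spectralRadius α * (n : ℝ) ^ ((r : ℝ) / α) / n.descFactorial r

theorem cast_descFactorial_succ_mul (hn : r ≤ n) :
    ((n + 1).descFactorial r : ℝ) * (1 - r * (1 / ((n + 1 : ℕ) : ℝ))) = n.descFactorial r := by
  have h := Nat.succ_descFactorial n r
  have h' : ((n + 1 - r : ℕ) : ℝ) = ((n + 1 : ℕ) : ℝ) - r := by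
    rw [Nat.cast_sub (by omega)]
  have h2 : (((n + 1 : ℕ) : ℝ) - r) * (n + 1).descFactorial r =
      ((n + 1 : ℕ) : ℝ) * n.descFactorial r := by
    rw [← h']
    exact_mod_cast h
  have h3 : ((n + 1 : ℕ) : ℝ) ≠ 0 := by positivity
  field_simp
  linarith

theorem descFactorial_cast_pos (hn : r ≤ n) : (0 : ℝ) < n.descFactorial r :=
  Nat.cast_pos.2 (Nat.pos_of_ne_zero fun h => by
    rw [Nat.descFactorial_eq_zero_iff_lt] at h; omega)

theorem normalizedRadius_nonneg (hα : 0 < α) (hn : n ≠ 0) (G : RGraph r (Fin n)) :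
    0 ≤ G.normalizedRadius α := by
  have : NeZero n := ⟨hn⟩
  have := G.spectralRadius_nonneg hα
  unfold normalizedRadius
  positivity

/-- Deleting a vertex whose weight is at most the average does not decrease the normalized radius,
and deleting one whose weight is clearly below the average increases it. -/
theorem IsMaximizer.normalizedRadius_deleteVertex_ge {G : RGraph r (Fin (n + 1))}
    {x : Fin (n + 1) → ℝ} (hr : 2 ≤ r) (hα : 1 < α) (hn : r ≤ n) (h : G.IsMaximizer α x)
    {k : Fin (n + 1)} (hk : x k ^ α ≤ 1 / ((n + 1 : ℕ) : ℝ)) :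
    G.normalizedRadius α *
        (1 + (r - max ((r : ℝ) / α) 1) * (1 / ((n + 1 : ℕ) : ℝ) - x k ^ α)) ≤
      (G.deleteVertex k).normalizedRadius α := by
  have hα0 : 0 < α := by linarith
  have hr' : (2 : ℝ) ≤ r := by exact_mod_cast hr
  have hn' : (r : ℝ) + 1 ≤ ((n + 1 : ℕ) : ℝ) := by exact_mod_cast Nat.succ_le_succ hn
  have hN : (0 : ℝ) < ((n + 1 : ℕ) : ℝ) := by positivity
  have hdel := h.spectralRadius_deleteVertex_ge (by omega) hα0 k
  have hfac := cast_descFactorial_succ_mul hn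
  set p := (r : ℝ) / α
  set s := x k ^ α
  set u := 1 / ((n + 1 : ℕ) : ℝ) with hu
  set l := G.spectralRadius α
  set l' := (G.deleteVertex k).spectralRadius α
  have hl : 0 ≤ l := G.spectralRadius_nonneg hα0
  have hs : 0 ≤ s := Real.rpow_nonneg (h.nonneg k) _
  have hu0 : 0 < u := by positivity
  have hru : r * u < 1 := by
    rw [hu, mul_one_div, div_lt_one hN]; linarith
  have hu1 : u < 1 := by nlinarith
  have hpr : max p 1 ≤ r := max_le (div_le_self (by positivity) hα.le) (by linarith)
  have hineq := deletion_inequality (p := p) hs hk hu1 hru.le hpr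
  have hsp : 0 < (1 - s) ^ p := Real.rpow_pos_of_pos (by linarith) _
  have hup : (0 : ℝ) ≤ (1 - u) ^ p := Real.rpow_nonneg (by linarith) _
  have hmain : l * ((1 - r * u) + (r - max p 1) * (u - s)) ≤ l' * (1 - u) ^ p := by
    have h1 := mul_le_mul_of_nonneg_left hineq hl
    have h2 := mul_le_mul_of_nonneg_right hdel hup
    refine le_of_mul_le_mul_left ?_ hsp
    linarith
  have hnp : (n : ℝ) ^ p = (1 - u) ^ p * ((n + 1 : ℕ) : ℝ) ^ p := by
    rw [← Real.mul_rpow (by linarith) hN.le]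
    congr 1
    rw [hu]
    field_simp
    push_cast
    ring
  have hD' := descFactorial_cast_pos hn
  have hD := descFactorial_cast_pos (n := n + 1) (r := r) (by omega)
  have hd : 0 ≤ (r - max p 1) * (u - s) := mul_nonneg (by linarith) (by linarith)
  unfold normalizedRadius
  rw [le_div_iff₀ hD', hnp, ← hfac]
  calc l * ((n + 1 : ℕ) : ℝ) ^ p / ((n + 1).descFactorial r) *
        (1 + (r - max p 1) * (u - s)) * (((n + 1).descFactorial r) * (1 - r * u))
      = l * ((n + 1 : ℕ) : ℝ) ^ p * ((1 + (r - max p 1) * (u - s)) * (1 - r * u)) := by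
        field_simp
    _ ≤ l * ((n + 1 : ℕ) : ℝ) ^ p * ((1 - r * u) + (r - max p 1) * (u - s)) := by
        gcongr
        have : 0 ≤ r * u := by positivity
        nlinarith
    _ = l * ((1 - r * u) + (r - max p 1) * (u - s)) * ((n + 1 : ℕ) : ℝ) ^ p := by ring
    _ ≤ l' * (1 - u) ^ p * ((n + 1 : ℕ) : ℝ) ^ p := by gcongr
    _ = _ := by ring

theorem IsMaximizer.exists_rpow_le {G : RGraph r (Fin n)} {x : Fin n → ℝ} (hn : n ≠ 0)
    (h : G.IsMaximizer α x) : ∃ k, x k ^ α ≤ 1 / (n : ℝ) := by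
  have : NeZero n := ⟨hn⟩
  obtain ⟨k, _, hk⟩ := Finset.exists_le_of_sum_le (s := Finset.univ) (f := fun k => x k ^ α)
    (g := fun _ => 1 / (n : ℝ)) Finset.univ_nonempty (by
      rw [h.sum_eq]; simp [hn])
  exact ⟨k, hk⟩

theorem IsMaximizer.exists_le_rpow {G : RGraph r (Fin n)} {x : Fin n → ℝ} (hn : n ≠ 0)
    (h : G.IsMaximizer α x) : ∃ k, 1 / (n : ℝ) ≤ x k ^ α := by
  have : NeZero n := ⟨hn⟩
  obtain ⟨k, _, hk⟩ := Finset.exists_le_of_sum_le (s := Finset.univ) (f := fun _ => 1 / (n : ℝ))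
    (g := fun k => x k ^ α) Finset.univ_nonempty (by
      rw [h.sum_eq]; simp [hn])
  exact ⟨k, hk⟩

theorem exists_deleteVertex_ge (hr : 2 ≤ r) (hα : 1 < α) (hn : r ≤ n)
    (G : RGraph r (Fin (n + 1))) :
    ∃ k, G.normalizedRadius α ≤ (G.deleteVertex k).normalizedRadius α := by
  have hα0 : 0 < α := by linarith
  obtain ⟨x, hx⟩ := G.exists_isMaximizer hα0
  obtain ⟨k, hk⟩ := hx.exists_rpow_le (Nat.succ_ne_zero n)
  refine ⟨k, le_trans ?_ (hx.normalizedRadius_deleteVertex_ge hr hα hn hk)⟩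
  have hpr : max ((r : ℝ) / α) 1 ≤ r :=
    max_le (div_le_self (by positivity) hα.le) (by exact_mod_cast (by omega : 1 ≤ r))
  refine le_mul_of_one_le_right (normalizedRadius_nonneg hα0 (Nat.succ_ne_zero n) G) ?_
  have := mul_nonneg (sub_nonneg.2 hpr) (sub_nonneg.2 hk)
  linarith

/-- Cloning a vertex of at least average weight loses only a factor `1 - O(1 / n ^ 2)`. -/
theorem exists_cloneVertex_ge (hr : 2 ≤ r) (hα : 1 < α) (hn : r ≤ n) (G : RGraph r (Fin n)) :
    ∃ k, G.normalizedRadius α * (1 - (r : ℝ) ^ 2 / (n : ℝ) ^ 2) ≤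
      (G.cloneVertex k).normalizedRadius α := by
  have hα0 : 0 < α := by linarith
  have hn0 : n ≠ 0 := by omega
  have : NeZero n := ⟨hn0⟩
  obtain ⟨x, hx⟩ := G.exists_isMaximizer hα0
  obtain ⟨k, hk⟩ := hx.exists_le_rpow hn0
  refine ⟨k, ?_⟩
  have hN : (0 : ℝ) < n := by positivity
  set s := x k ^ α
  set p := (r : ℝ) / α with hp
  have hp0 : 0 < p := by positivity
  set u := 1 / (n : ℝ) with hu
  have hu0 : 0 < u := by positivity
  have hs0 : 0 < s := hu0.trans_le hk
  -- The weight `t * x k` of the twin is chosen with `t * x k ^ α = 1 / n`. As `t ≤ 1`, it adds at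
  -- most `1 / n` to the sum of the `α`-th powers.
  set t := u / s with ht
  have ht0 : 0 < t := by positivity
  have hts : t * s = u := div_mul_cancel₀ _ hs0.ne'
  have ht1 : t ≤ 1 := (div_le_one hs0).2 hk
  have htα : t ^ α * s ≤ u := by
    rw [← hts]
    gcongr
    exact Real.rpow_le_self_of_le_one ht0.le ht1 hα.le
  have hcl := hx.spectralRadius_cloneVertex_ge (by omega) hα0 k ht0.le
  rw [hts] at hcl
  set l := G.spectralRadius α
  set l' := (G.cloneVertex k).spectralRadius α
  have hl : 0 ≤ l := G.spectralRadius_nonneg hα0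
  have hl' : 0 ≤ l' := (G.cloneVertex k).spectralRadius_nonneg hα0
  have hcl2 : l * (1 + r * u) ≤ l' * (1 + u) ^ p := by
    refine hcl.trans ?_
    gcongr
  have hnp : ((n + 1 : ℕ) : ℝ) ^ p = (1 + u) ^ p * (n : ℝ) ^ p := by
    rw [← Real.mul_rpow (by linarith) hN.le]
    congr 1
    rw [hu]
    field_simp
    push_cast
    ring
  have hfac := cast_descFactorial_succ_mul hn
  have hD' := descFactorial_cast_pos hn
  have hD := descFactorial_cast_pos (n := n + 1) (r := r) (by omega)
  unfold normalizedRadius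
  rw [le_div_iff₀ hD, hnp, ← hfac]
  set D := ((n + 1).descFactorial r : ℝ)
  set v := 1 / ((n + 1 : ℕ) : ℝ) with hv
  have hrv : 0 < 1 - r * v := by
    rw [← hfac] at hD'
    exact (mul_pos_iff_of_pos_left hD).1 hD'
  have hvu : v ≤ u := by
    rw [hv, hu]
    gcongr
    omega
  have hv0 : 0 < v := by positivity
  have hkey : 1 - (r : ℝ) ^ 2 / (n : ℝ) ^ 2 ≤ (1 + r * u) * (1 - r * v) := by
    have h1 : (r : ℝ) ^ 2 / (n : ℝ) ^ 2 = (r * u) ^ 2 := by rw [hu]; field_simp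
    have h2 : (r : ℝ) * v ≤ r * u := by gcongr
    have h3 : (r * u) * (r * v) ≤ (r * u) ^ 2 := by
      rw [sq]; gcongr
    rw [h1]
    nlinarith
  calc l * (n : ℝ) ^ p / (D * (1 - r * v)) * (1 - (r : ℝ) ^ 2 / (n : ℝ) ^ 2) * D
      = l * (n : ℝ) ^ p * ((1 - (r : ℝ) ^ 2 / (n : ℝ) ^ 2) / (1 - r * v)) := by
        field_simp
    _ ≤ l * (n : ℝ) ^ p * (1 + r * u) := by
        gcongr
        rwa [div_le_iff₀ hrv]
    _ = l * (1 + r * u) * (n : ℝ) ^ p := by ring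
    _ ≤ l' * (1 + u) ^ p * (n : ℝ) ^ p := by gcongr
    _ = _ := by ring

theorem card_edges_div_choose_le_normalizedRadius (hα : 0 < α) (hn : n ≠ 0)
    (G : RGraph r (Fin n)) :
    (G.edges.card : ℝ) / n.choose r ≤ G.normalizedRadius α := by
  have hN : (0 : ℝ) < n := by positivity
  set u : ℝ := (1 / (n : ℝ)) ^ (1 / α)
  have hu : 0 < u := by positivity
  have huα : u ^ α = 1 / n := by
    rw [← Real.rpow_mul (by positivity), one_div_mul_cancel hα.ne', Real.rpow_one]
  have h := lagrangianPoly_le_spectralRadius hα G (x := fun _ => u) (fun _ => hu.le) (by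
    simp [huα, hn])
  rw [lagrangianPoly_const] at h
  have hun : u ^ r * (n : ℝ) ^ ((r : ℝ) / α) = 1 := by
    rw [← Real.rpow_natCast, ← Real.rpow_mul (by positivity), one_div_mul_eq_div,
      ← Real.mul_rpow (by positivity) hN.le, one_div_mul_cancel hN.ne', Real.one_rpow]
  have h2 : (n.descFactorial r : ℝ) = Nat.factorial r * n.choose r := by
    exact_mod_cast Nat.descFactorial_eq_factorial_mul_choose n r
  unfold normalizedRadius
  rw [h2]
  calc (G.edges.card : ℝ) / n.choose r
      = (Nat.factorial r * G.edges.card * u ^ r) * (n : ℝ) ^ ((r : ℝ) / α) /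
          (Nat.factorial r * n.choose r) := by
        rw [mul_assoc, hun, mul_one, mul_div_mul_left _ _ (by positivity)]
    _ ≤ _ := by gcongr

end RGraph

/-! ### Degrees of graphs with a nearly constant maximizer -/

namespace RGraph

variable {r n : ℕ} {α : ℝ}

/-- If all weights are at least `b`, then the products over `(r - 1)`-sets outside the link of `v`
are at least `b ^ (r - 1)`, so that the link polynomial is bounded in terms of the degree of `v` and
the power `(∑ i, x i) ^ (r - 1)`. -/
theorem linkPoly_le (hr : 1 ≤ r) (G : RGraph r (Fin n)) (v : Fin n) {x : Fin n → ℝ} {b : ℝ}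
    (hb : 0 ≤ b) (hx : ∀ i, b ≤ x i) :
    G.linkPoly v x ≤ r * (Nat.factorial (r - 1) * G.degree v * b ^ (r - 1) +
      (∑ i, x i) ^ (r - 1) - n.descFactorial (r - 1) * b ^ (r - 1)) := by
  obtain ⟨q, rfl⟩ : ∃ q, r = q + 1 := ⟨r - 1, by omega⟩
  rw [Nat.add_sub_cancel]
  set E := G.edges.filter (fun e => v ∈ e)
  have hcard : ∀ e ∈ E, (e.erase v).card = q := fun e he => by
    obtain ⟨he, hv⟩ := Finset.mem_filter.1 he
    rw [Finset.card_erase_of_mem hv, G.card_of_mem_edges he, Nat.add_sub_cancel]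
  have hinj : Set.InjOn (fun e : Finset (Fin n) => e.erase v) E := by
    intro e he f hf hef
    rw [← Finset.insert_erase (Finset.mem_filter.1 he).2,
      ← Finset.insert_erase (Finset.mem_filter.1 hf).2]
    exact congrArg (insert v) hef
  have hterm : ∀ f : Finset (Fin n), f.card = q → b ^ q ≤ ∏ i ∈ f, x i := fun f hf => by
    rw [← hf, ← Finset.prod_const]
    exact Finset.prod_le_prod (fun _ _ => hb) fun i _ => hx i
  have h1 : ∑ e ∈ E, (∏ i ∈ e.erase v, x i - b ^ q) ≤
      ∑ f ∈ Finset.univ.powersetCard q, (∏ i ∈ f, x i - b ^ q) := by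
    rw [← Finset.sum_image (f := fun f => ∏ i ∈ f, x i - b ^ q) hinj]
    refine Finset.sum_le_sum_of_subset_of_nonneg ?_ ?_
    · intro f hf
      obtain ⟨e, he, rfl⟩ := Finset.mem_image.1 hf
      exact Finset.mem_powersetCard.2 ⟨Finset.subset_univ _, hcard e he⟩
    · intro f hf _
      exact sub_nonneg.2 (hterm f (Finset.mem_powersetCard.1 hf).2)
  have h2 := factorial_mul_sum_powersetCard_prod_le Finset.univ (fun i => hb.trans (hx i)) q
  rw [Finset.sum_sub_distrib, Finset.sum_sub_distrib, Finset.sum_const, Finset.sum_const,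
    Finset.card_powersetCard, Finset.card_univ, Fintype.card_fin, nsmul_eq_mul, nsmul_eq_mul] at h1
  have h3 : (n.descFactorial q : ℝ) = Nat.factorial q * n.choose q := by
    exact_mod_cast Nat.descFactorial_eq_factorial_mul_choose n q
  have hE : E.card = G.degree v := rfl
  have h4 := mul_le_mul_of_nonneg_left h1 (Nat.cast_nonneg (α := ℝ) (Nat.factorial q))
  rw [hE] at h4
  unfold linkPoly
  rw [Nat.factorial_succ, Nat.cast_mul, mul_assoc, h3]
  refine mul_le_mul_of_nonneg_left ?_ (Nat.cast_nonneg _)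
  linarith

/-- A lower bound for the degrees of a graph with a nearly constant maximizer. -/
theorem IsMaximizer.degree_ge {G : RGraph r (Fin n)} {x : Fin n → ℝ} (hr : 2 ≤ r) (hα : 1 < α)
    (hn : r ≤ n) (h : G.IsMaximizer α x) {D β : ℝ}
    (hG : D ≤ G.normalizedRadius α) (hβ0 : 0 < β) (hβ1 : β ≤ 1)
    (hβ : ∀ i, β ^ α / n ≤ x i ^ α) (v : Fin n) :
    D * β ^ (α - 1) * (n.descFactorial r / n) + n.descFactorial (r - 1) * β ^ (r - 1) -
      (n : ℝ) ^ (r - 1) ≤ Nat.factorial (r - 1) * G.degree v := by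
  have hα0 : 0 < α := by linarith
  have hn0 : n ≠ 0 := by omega
  have hN : (0 : ℝ) < n := by positivity
  set u : ℝ := (1 / (n : ℝ)) ^ (1 / α)
  have hu : 0 < u := by positivity
  have huα : u ^ α = 1 / n := by
    rw [← Real.rpow_mul (by positivity), one_div_mul_cancel hα0.ne', Real.rpow_one]
  have hun : u ^ r * (n : ℝ) ^ ((r : ℝ) / α) = 1 := by
    rw [← Real.rpow_natCast, ← Real.rpow_mul (by positivity), one_div_mul_eq_div,
      ← Real.mul_rpow (by positivity) hN.le, one_div_mul_cancel hN.ne', Real.one_rpow]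
  have hx : ∀ i, β * u ≤ x i := fun i => by
    rw [← Real.rpow_le_rpow_iff (by positivity) (h.nonneg i) hα0, Real.mul_rpow hβ0.le hu.le, huα,
      mul_one_div]
    exact hβ i
  have hb : 0 < β * u := by positivity
  have hlink := G.linkPoly_le (by omega) v hb.le hx
  rw [h.linkPoly_eq (by omega) hα0 (hb.trans_le (hx v)), mul_assoc] at hlink
  have hlink := le_of_mul_le_mul_left hlink (by positivity)
  set l := G.spectralRadius α
  have hl : 0 ≤ l := by
    have : Nonempty (Fin n) := ⟨v⟩
    exact G.spectralRadius_nonneg hα0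
  -- The power mean inequality bounds the `ℓ¹`-norm of the maximizer.
  have hsum : ∑ i, x i ≤ n * u := by
    have hs0 : 0 ≤ ∑ i, x i := Finset.sum_nonneg fun i _ => h.nonneg i
    have := Real.rpow_sum_le_const_mul_sum_rpow Finset.univ x hα.le
    simp only [abs_of_nonneg (h.nonneg _), h.sum_eq, Finset.card_univ, Fintype.card_fin,
      mul_one] at this
    rw [← Real.rpow_le_rpow_iff hs0 (by positivity) hα0, Real.mul_rpow hN.le hu.le, huα,
      mul_one_div, ← Real.rpow_sub_one hN.ne']
    exact this
  have hl2 : D * n.descFactorial r * u ^ r ≤ l := by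
    have h1 : D * n.descFactorial r ≤ l * (n : ℝ) ^ ((r : ℝ) / α) := by
      rwa [normalizedRadius, le_div_iff₀ (descFactorial_cast_pos hn)] at hG
    calc D * n.descFactorial r * u ^ r ≤ l * (n : ℝ) ^ ((r : ℝ) / α) * u ^ r := by gcongr
      _ = l * (u ^ r * (n : ℝ) ^ ((r : ℝ) / α)) := by ring
      _ = l := by rw [hun, mul_one]
  have hxv : (β * u) ^ (α - 1) ≤ x v ^ (α - 1) :=
    Real.rpow_le_rpow hb.le (hx v) (by linarith)
  have hu1 : u * u ^ (α - 1) = 1 / n := by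
    rw [Real.rpow_sub_one hu.ne', huα]
    field_simp
  have hur : u ^ r = u ^ (r - 1) * u := by rw [← pow_succ]; congr 1; omega
  have hchain : D * β ^ (α - 1) * (n.descFactorial r / n) * u ^ (r - 1) ≤
      (Nat.factorial (r - 1) * G.degree v * β ^ (r - 1) + (n : ℝ) ^ (r - 1) -
        n.descFactorial (r - 1) * β ^ (r - 1)) * u ^ (r - 1) := by
    calc D * β ^ (α - 1) * (n.descFactorial r / n) * u ^ (r - 1)
        = D * n.descFactorial r * u ^ r * (β * u) ^ (α - 1) := by
          rw [Real.mul_rpow hβ0.le hu.le, hur]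
          linear_combination (-D * n.descFactorial r * u ^ (r - 1) * β ^ (α - 1)) * hu1
      _ ≤ l * x v ^ (α - 1) := by gcongr
      _ ≤ _ := hlink
      _ ≤ Nat.factorial (r - 1) * G.degree v * (β * u) ^ (r - 1) + (n * u) ^ (r - 1) -
            n.descFactorial (r - 1) * (β * u) ^ (r - 1) := by
          gcongr
          exact Finset.sum_nonneg fun i _ => h.nonneg i
      _ = _ := by simp only [mul_pow]; ring
  have hchain := le_of_mul_le_mul_right hchain (by positivity)
  have : (Nat.factorial (r - 1) * G.degree v : ℝ) * β ^ (r - 1) ≤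
      Nat.factorial (r - 1) * G.degree v :=
    mul_le_of_le_one_right (by positivity) (pow_le_one₀ hβ0.le hβ1)
  linarith

theorem pow_mul_le_descFactorial {k : ℕ} (hk : k ≤ r) (hn : r ≤ n) (hn0 : n ≠ 0) :
    (n : ℝ) ^ k * (1 - (r : ℝ) ^ 2 / n) ≤ n.descFactorial k := by
  have hN : (0 : ℝ) < n := by positivity
  have hrn : (r : ℝ) / n ≤ 1 := (div_le_one hN).2 (by exact_mod_cast hn)
  have h1 : ((n : ℝ) - r) ^ k ≤ n.descFactorial k := by
    rw [← Nat.cast_sub hn]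
    calc (((n - r : ℕ) : ℝ)) ^ k ≤ ((n + 1 - k : ℕ) : ℝ) ^ k := by
          gcongr
          omega
      _ ≤ _ := by exact_mod_cast Nat.pow_sub_le_descFactorial n k
  have h2 : 1 + (k : ℝ) * -(r / n) ≤ (1 + -((r : ℝ) / n)) ^ k :=
    one_add_mul_le_pow (by linarith) k
  have hk' : (k : ℝ) * (r / n) ≤ (r : ℝ) ^ 2 / n := by
    rw [sq, mul_div_assoc]
    gcongr
  calc (n : ℝ) ^ k * (1 - (r : ℝ) ^ 2 / n) ≤ (n : ℝ) ^ k * (1 + -((r : ℝ) / n)) ^ k := by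
        gcongr
        linarith
    _ = ((n : ℝ) - r) ^ k := by
        rw [← mul_pow]
        congr 1
        field_simp
        ring
    _ ≤ _ := h1

/-- Graphs of normalized radius at least `D` with a maximizer all of whose weights are close to or
above the average have minimum degree close to or above `D * n ^ (r - 1) / (r - 1)!`. -/
theorem exists_minDegree_ge (hr : 2 ≤ r) (hα : 1 < α) {D ε : ℝ} (hD : 0 ≤ D) (hε : 0 < ε) :
    ∃ η : ℝ, 0 < η ∧ ∃ N : ℕ, ∀ n ≥ N, ∀ (G : RGraph r (Fin n)) (x : Fin n → ℝ),
      G.IsMaximizer α x → D ≤ G.normalizedRadius α → (∀ i, (1 - η) / n ≤ x i ^ α) →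
      (D / Nat.factorial (r - 1) - ε) * (n : ℝ) ^ (r - 1) ≤ G.minDegree := by
  have hα0 : 0 < α := by linarith
  set δ : ℝ := Nat.factorial (r - 1) * ε
  have hδ : 0 < δ := by positivity
  have hcont : ContinuousAt (fun β : ℝ => D * β ^ (α - 1) + β ^ (r - 1)) 1 := by
    refine ContinuousAt.add (ContinuousAt.mul continuousAt_const ?_) (by fun_prop)
    exact Real.continuousAt_rpow_const 1 _ (Or.inl one_ne_zero)
  have hev : ∀ᶠ β : ℝ in nhdsWithin 1 (Set.Iio 1),
      D + 1 - δ < D * β ^ (α - 1) + β ^ (r - 1) ∧ 0 < β := by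
    refine (nhdsWithin_le_nhds (s := Set.Iio (1 : ℝ)) ?_)
    have h1 : D + 1 - δ < D * (1 : ℝ) ^ (α - 1) + 1 ^ (r - 1) := by
      rw [Real.one_rpow, one_pow]
      linarith
    exact (hcont.eventually (lt_mem_nhds h1)).and (lt_mem_nhds zero_lt_one)
  obtain ⟨β, ⟨hβ, hβ0⟩, hβ1⟩ := (hev.and self_mem_nhdsWithin).exists
  have hβ1 : β < 1 := hβ1
  set A := D * β ^ (α - 1) + β ^ (r - 1)
  have hlim : Tendsto (fun n : ℕ => A * (1 - (r : ℝ) ^ 2 / n)) atTop (nhds (A * (1 - 0))) :=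
    (tendsto_const_nhds.sub (tendsto_const_div_atTop_nhds_zero_nat _)).const_mul _
  rw [sub_zero, mul_one] at hlim
  obtain ⟨N, hN⟩ := eventually_atTop.1 (hlim.eventually (lt_mem_nhds hβ))
  refine ⟨1 - β ^ α, sub_pos.2 (Real.rpow_lt_one hβ0.le hβ1 hα0), max N r, ?_⟩
  intro n hn G x hx hG hi
  have hrn : r ≤ n := le_of_max_le_right hn
  have hn0 : n ≠ 0 := by omega
  have : NeZero n := ⟨hn0⟩
  have hNn : (0 : ℝ) < n := by positivity
  obtain ⟨v, hv⟩ : ∃ v, G.degree v = G.minDegree :=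
    Nat.sInf_mem (s := Set.range fun v => G.degree v) (Set.range_nonempty _)
  rw [← hv]
  have hdeg := hx.degree_ge hr hα hrn hG hβ0 hβ1.le (fun i => by simpa using hi i) v
  have h1 := pow_mul_le_descFactorial (n := n) le_rfl hrn hn0
  have h2 := pow_mul_le_descFactorial (n := n) (Nat.sub_le r 1) hrn hn0
  have h3 : (n : ℝ) ^ (r - 1) * (1 - (r : ℝ) ^ 2 / n) ≤ n.descFactorial r / n := by
    rw [le_div_iff₀ hNn]
    refine le_trans (le_of_eq ?_) h1
    have : (n : ℝ) ^ r = (n : ℝ) ^ (r - 1) * n := by rw [← pow_succ]; congr 1; omega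
    rw [this]
    ring
  have h4 : (n : ℝ) ^ (r - 1) * (A * (1 - (r : ℝ) ^ 2 / n) - 1) ≤
      Nat.factorial (r - 1) * G.degree v := by
    refine le_trans ?_ hdeg
    have h5 : D * β ^ (α - 1) * ((n : ℝ) ^ (r - 1) * (1 - (r : ℝ) ^ 2 / n)) ≤
        D * β ^ (α - 1) * (n.descFactorial r / n) := by gcongr
    have h6 : (n : ℝ) ^ (r - 1) * (1 - (r : ℝ) ^ 2 / n) * β ^ (r - 1) ≤
        n.descFactorial (r - 1) * β ^ (r - 1) := by gcongr
    simp only [A]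
    linarith
  have h7 : (n : ℝ) ^ (r - 1) * (D - δ) ≤ Nat.factorial (r - 1) * G.degree v := by
    refine le_trans ?_ h4
    have := hN n (le_of_max_le_left hn)
    exact mul_le_mul_of_nonneg_left (by linarith) (by positivity)
  have hf : (0 : ℝ) < Nat.factorial (r - 1) := by positivity
  refine le_of_mul_le_mul_left ?_ hf
  refine le_trans (le_of_eq ?_) h7
  simp only [δ]
  field_simp

end RGraph

/-! ### Edge density -/

namespace RGraphFamily

variable {r : ℕ}

theorem bddAbove_card_edges (𝒬 : RGraphFamily r) (n : ℕ) :
    BddAbove ((fun G : RGraph r (Fin n) => G.edges.card) '' 𝒬 n) :=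
  (Set.toFinite _).bddAbove

theorem exists_card_edges_eq_ex {𝒬 : RGraphFamily r} {n : ℕ} (h : 𝒬.ex n ≠ 0) :
    ∃ G ∈ 𝒬 n, G.edges.card = 𝒬.ex n := by
  refine Nat.sSup_mem (s := (fun G : RGraph r (Fin n) => G.edges.card) '' 𝒬 n) ?_
    (bddAbove_card_edges 𝒬 n)
  by_contra hne
  rw [Set.not_nonempty_iff_eq_empty] at hne
  exact h (by rw [ex, hne, csSup_empty]; rfl)

theorem sum_degree_eq {V : Type*} [Fintype V] [DecidableEq V] (G : RGraph r V) :
    ∑ v, G.degree v = r * G.edges.card := by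
  simp only [RGraph.degree, Finset.card_filter]
  rw [Finset.sum_comm, mul_comm, ← smul_eq_mul, ← Finset.sum_const]
  refine Finset.sum_congr rfl fun e he => ?_
  rw [← Finset.card_filter, ← G.card_of_mem_edges he]
  congr 1
  ext v
  simp

/-- The Katona–Nemetz–Simonovits averaging argument. -/
theorem ex_succ_mul_le {𝒬 : RGraphFamily r}
    (h𝒬 : ∀ n, ∀ G ∈ 𝒬 (n + 1), ∀ k, G.deleteVertex k ∈ 𝒬 n) (n : ℕ) :
    𝒬.ex (n + 1) * (n + 1) ≤ (n + 1) * 𝒬.ex n + r * 𝒬.ex (n + 1) := by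
  by_cases h : 𝒬.ex (n + 1) = 0
  · simp [h]
  obtain ⟨G, hG, hcard⟩ := exists_card_edges_eq_ex h
  have h1 : ∑ k : Fin (n + 1), G.edges.card ≤ ∑ k, (𝒬.ex n + G.degree k) := by
    refine Finset.sum_le_sum fun k _ => ?_
    rw [G.card_edges_eq_deleteVertex_add_degree k]
    exact Nat.add_le_add_right (le_csSup (bddAbove_card_edges 𝒬 n) ⟨_, h𝒬 n G hG k, rfl⟩) _
  rw [Finset.sum_add_distrib, sum_degree_eq, Finset.sum_const, Finset.sum_const, hcard] at h1
  simp only [Finset.card_univ, Fintype.card_fin, smul_eq_mul] at h1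
  linarith

theorem edgeDensity_le {𝒬 : RGraphFamily r}
    (h𝒬 : ∀ n, ∀ G ∈ 𝒬 (n + 1), ∀ k, G.deleteVertex k ∈ 𝒬 n) {n : ℕ} (hn : r ≤ n) :
    𝒬.edgeDensity ≤ (𝒬.ex n : ℝ) / n.choose r := by
  set f : ℕ → ℝ := fun n => (𝒬.ex n : ℝ) / n.choose r
  have hanti : Antitone fun m => f (m + r) := by
    refine antitone_nat_of_succ_le fun m => ?_
    set n := m + r with hn
    rw [show m + 1 + r = n + 1 by omega]
    have h1 := ex_succ_mul_le h𝒬 n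
    have h1' : (𝒬.ex (n + 1) : ℝ) * (n + 1) ≤ (n + 1) * 𝒬.ex n + r * 𝒬.ex (n + 1) := by
      exact_mod_cast h1
    have h2 : ((n + 1).choose r : ℝ) * (n + 1 - r) = (n + 1) * n.choose r := by
      have := Nat.choose_mul_succ_eq n r
      have h3 : ((n + 1 - r : ℕ) : ℝ) = (n : ℝ) + 1 - r := by
        rw [Nat.cast_sub (by omega)]; push_cast; ring
      rw [← h3]
      have := this.symm
      rw [Nat.mul_comm (n.choose r)] at this
      exact_mod_cast this
    have hc1 : (0 : ℝ) < (n + 1).choose r := Nat.cast_pos.2 (Nat.choose_pos (by omega))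
    have hc2 : (0 : ℝ) < n.choose r := Nat.cast_pos.2 (Nat.choose_pos (by omega))
    have hnr : (0 : ℝ) < n + 1 - r := by
      have : (r : ℝ) ≤ n := by exact_mod_cast (by omega : r ≤ n)
      linarith
    have hn1 : (0 : ℝ) < n + 1 := by positivity
    change (𝒬.ex (n + 1) : ℝ) / (n + 1).choose r ≤ (𝒬.ex n : ℝ) / n.choose r
    rw [div_le_div_iff₀ hc1 hc2]
    refine le_of_mul_le_mul_left ?_ hn1
    calc ((n : ℝ) + 1) * (𝒬.ex (n + 1) * n.choose r)
        = 𝒬.ex (n + 1) * (n + 1 - r) * (n + 1).choose r := by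
          linear_combination (-(𝒬.ex (n + 1) : ℝ)) * h2
      _ ≤ ((n + 1) * 𝒬.ex n) * (n + 1).choose r := by
          exact mul_le_mul_of_nonneg_right (by linarith) hc1.le
      _ = _ := by ring
  have hbdd : BddBelow (Set.range fun m => f (m + r)) :=
    ⟨0, by rintro _ ⟨m, rfl⟩; positivity⟩
  have hlim := (tendsto_add_atTop_iff_nat r).1 (tendsto_atTop_ciInf hanti hbdd)
  have h : 𝒬.edgeDensity = ⨅ m, f (m + r) := hlim.limUnder_eq
  rw [h]
  have := ciInf_le hbdd (n - r)
  rwa [Nat.sub_add_cancel hn] at this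

end RGraphFamily

/-! ### Products of factors close to one -/

theorem tendsto_prod_Ico_one_add_atTop {c : ℝ} (hc : 0 < c) (a : ℕ) :
    Tendsto (fun n => ∏ j ∈ Finset.Ico a n, (1 + c / ((j : ℝ) + 1))) atTop atTop := by
  have hsum : ∀ s : Finset ℕ, 1 + c * ∑ j ∈ s, 1 / ((j : ℝ) + 1) ≤
      ∏ j ∈ s, (1 + c / ((j : ℝ) + 1)) := fun s => by
    induction s using Finset.induction_on with
    | empty => simp
    | insert j s hj ih =>
      rw [Finset.sum_insert hj, Finset.prod_insert hj]
      have h1 : 0 ≤ c / ((j : ℝ) + 1) := by positivity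
      have h2 : 0 ≤ c * ∑ j ∈ s, 1 / ((j : ℝ) + 1) := by positivity
      have h3 : c * (1 / ((j : ℝ) + 1)) = c / ((j : ℝ) + 1) := mul_one_div _ _
      rw [mul_add, h3]
      nlinarith [mul_nonneg h1 h2, mul_le_mul_of_nonneg_left ih h1]
  have hlim : Tendsto (fun n => 1 + c * (∑ j ∈ Finset.range n, 1 / ((j : ℝ) + 1) -
      ∑ j ∈ Finset.range a, 1 / ((j : ℝ) + 1))) atTop atTop := by
    refine tendsto_atTop_add_const_left _ _ (Tendsto.const_mul_atTop hc ?_)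
    exact tendsto_atTop_add_const_right _ _ Real.tendsto_sum_range_one_div_nat_succ_atTop
  refine tendsto_atTop_mono' _ ?_ hlim
  filter_upwards [eventually_ge_atTop a] with n hn
  rw [← Finset.sum_Ico_eq_sub _ hn]
  exact hsum _

/-- For large `j`, an increase by a factor `1 + Θ(1 / j)` outweighs a decrease by a factor
`1 - O(1 / j ^ 2)`. -/
theorem eventually_one_lt_mul {c : ℝ} (hc : 0 < c) (q : ℝ) :
    ∃ J : ℕ, ∀ j : ℕ, J ≤ j → 1 < (1 + c / ((j : ℝ) + 1)) * (1 - q ^ 2 / (j : ℝ) ^ 2) := by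
  obtain ⟨J, hJ⟩ := exists_nat_gt (2 * q ^ 2 * (1 + c) / c)
  refine ⟨J + 1, fun j hj => ?_⟩
  have hj' : ((J : ℝ)) + 1 ≤ j := by exact_mod_cast hj
  have hj1 : (1 : ℝ) ≤ j := by
    have : (0 : ℝ) ≤ J := Nat.cast_nonneg J
    linarith
  have hj0 : (0 : ℝ) < j := by linarith
  rw [div_lt_iff₀ hc] at hJ
  have h1 : 2 * q ^ 2 * (1 + c) < j * c := by nlinarith
  have h2 : (1 + c / ((j : ℝ) + 1)) * (1 - q ^ 2 / (j : ℝ) ^ 2) - 1 =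
      (c * (j : ℝ) ^ 2 - q ^ 2 * (j + 1 + c)) / (((j : ℝ) + 1) * (j : ℝ) ^ 2) := by
    field_simp
    ring
  have h3 : 0 < c * (j : ℝ) ^ 2 - q ^ 2 * (j + 1 + c) := by
    have h4 : q ^ 2 * (j + 1 + c) ≤ 2 * q ^ 2 * (1 + c) * j := by
      have : (j : ℝ) + 1 + c ≤ 2 * (1 + c) * j := by nlinarith
      nlinarith [sq_nonneg q]
    nlinarith
  have := div_pos h3 (by positivity : 0 < ((j : ℝ) + 1) * (j : ℝ) ^ 2)
  linarith

/-! ### Spectral extremal numbers of `Col P` -/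

namespace RGraphFamily

open RGraph

variable {r : ℕ} {α : ℝ}

theorem spectralRadius_le_spectralEx {𝒬 : RGraphFamily r} {n : ℕ} {G : RGraph r (Fin n)}
    (hG : G ∈ 𝒬 n) : G.spectralRadius α ≤ 𝒬.spectralEx α n :=
  le_csSup (Set.toFinite _).bddAbove ⟨G, hG, rfl⟩

theorem exists_spectralRadius_eq_spectralEx {𝒬 : RGraphFamily r} {n : ℕ} (h : (𝒬 n).Nonempty) :
    ∃ G ∈ 𝒬 n, G.spectralRadius α = 𝒬.spectralEx α n :=
  (h.image _).csSup_mem (Set.toFinite _)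

theorem Col_nonempty (P : Pattern r) (n : ℕ) : (Col P n).Nonempty :=
  ⟨⟨∅, by simp⟩, fun _ => ⟨0, P.l_pos⟩, by simp⟩

/-- The largest normalized radius of an `n`-vertex member of `𝒬`. -/
noncomputable def normalizedEx (α : ℝ) (𝒬 : RGraphFamily r) (n : ℕ) : ℝ :=
  𝒬.spectralEx α n * (n : ℝ) ^ ((r : ℝ) / α) / n.descFactorial r

theorem normalizedRadius_le_normalizedEx {𝒬 : RGraphFamily r} {n : ℕ} {G : RGraph r (Fin n)}
    (h : G.spectralRadius α ≤ 𝒬.spectralEx α n) : G.normalizedRadius α ≤ 𝒬.normalizedEx α n := by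
  unfold normalizedRadius normalizedEx
  gcongr

theorem normalizedEx_le_normalizedRadius {𝒬 : RGraphFamily r} {n : ℕ} {G : RGraph r (Fin n)}
    (h : 𝒬.spectralEx α n ≤ G.spectralRadius α) : 𝒬.normalizedEx α n ≤ G.normalizedRadius α := by
  unfold normalizedRadius normalizedEx
  gcongr

theorem exists_normalizedRadius_eq {𝒬 : RGraphFamily r} {n : ℕ} (h : (𝒬 n).Nonempty) :
    ∃ G ∈ 𝒬 n, G.normalizedRadius α = 𝒬.normalizedEx α n := by
  obtain ⟨G, hG, h⟩ := exists_spectralRadius_eq_spectralEx (α := α) h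
  exact ⟨G, hG, by rw [normalizedRadius, normalizedEx, h]⟩

theorem normalizedEx_Col_succ_le (hr : 2 ≤ r) (hα : 1 < α) (P : Pattern r) {n : ℕ} (hn : r ≤ n) :
    (Col P).normalizedEx α (n + 1) ≤ (Col P).normalizedEx α n := by
  obtain ⟨G, hG, h⟩ := exists_normalizedRadius_eq (α := α) (Col_nonempty P (n + 1))
  obtain ⟨k, hk⟩ := G.exists_deleteVertex_ge hr hα hn
  rw [← h]
  exact hk.trans (normalizedRadius_le_normalizedEx
    (spectralRadius_le_spectralEx (Colorable.pullback hG _)))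

theorem normalizedEx_Col_mul_le_succ (hr : 2 ≤ r) (hα : 1 < α) (P : Pattern r) {n : ℕ}
    (hn : r ≤ n) :
    (Col P).normalizedEx α n * (1 - (r : ℝ) ^ 2 / (n : ℝ) ^ 2) ≤
      (Col P).normalizedEx α (n + 1) := by
  obtain ⟨G, hG, h⟩ := exists_normalizedRadius_eq (α := α) (Col_nonempty P n)
  obtain ⟨k, hk⟩ := G.exists_cloneVertex_ge hr hα hn
  rw [← h]
  exact hk.trans (normalizedRadius_le_normalizedEx
    (spectralRadius_le_spectralEx (Colorable.pullback hG _)))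

/-- The normalized spectral extremal numbers of `Col P` decrease slowly, by iterated cloning. -/
theorem normalizedEx_Col_mul_prod_le (hr : 2 ≤ r) (hα : 1 < α) (P : Pattern r) {m n : ℕ}
    (hm : r ≤ m) (hmn : m ≤ n) :
    (Col P).normalizedEx α m * ∏ j ∈ Finset.Ico m n, (1 - (r : ℝ) ^ 2 / (j : ℝ) ^ 2) ≤
      (Col P).normalizedEx α n := by
  induction n, hmn using Nat.le_induction with
  | base => simp
  | succ n hmn ih =>
    rw [Finset.prod_Ico_succ_top hmn, ← mul_assoc]
    refine le_trans ?_ (normalizedEx_Col_mul_le_succ hr hα P (hm.trans hmn))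
    refine mul_le_mul_of_nonneg_right ih (sub_nonneg.2 ?_)
    have hrn : (r : ℝ) ≤ n := by exact_mod_cast hm.trans hmn
    have hr0 : (0 : ℝ) < r := Nat.cast_pos.2 (by omega)
    have hn0 : (0 : ℝ) < n := hr0.trans_le hrn
    rw [div_le_one (by positivity)]
    gcongr

/-! ### Deletion of light vertices and degree-stability -/

/-- Iterated deletion of light vertices: if outside `ℌ` one can always delete a vertex and gain a
factor `1 + c / n` in the normalized radius, then one can continue until the order is `a` or the
graph lies in `ℌ`. -/
theorem exists_descent {𝒬 ℌ : RGraphFamily r} {c D : ℝ} (hc : 0 < c) (hD : 0 ≤ D) {a : ℕ}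
    (hstep : ∀ n ≥ a, ∀ G ∈ 𝒬 (n + 1), D ≤ G.normalizedRadius α → G ∉ ℌ (n + 1) →
      ∃ H ∈ 𝒬 n, G.normalizedRadius α * (1 + c / ((n : ℝ) + 1)) ≤ H.normalizedRadius α)
    {n : ℕ} (hn : a ≤ n) (G : RGraph r (Fin n)) (hG : G ∈ 𝒬 n) (hDG : D ≤ G.normalizedRadius α) :
    ∃ m, a ≤ m ∧ m ≤ n ∧ ∃ H ∈ 𝒬 m,
      G.normalizedRadius α * ∏ j ∈ Finset.Ico m n, (1 + c / ((j : ℝ) + 1)) ≤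
        H.normalizedRadius α ∧
      (m = a ∨ H ∈ ℌ m ∧ (m = n → G ∈ ℌ n)) := by
  induction n, hn using Nat.le_induction with
  | base => exact ⟨a, le_rfl, le_rfl, G, hG, by simp, Or.inl rfl⟩
  | succ n hn ih =>
    by_cases hGH : G ∈ ℌ (n + 1)
    · exact ⟨n + 1, hn.trans (Nat.le_succ n), le_rfl, G, hG, by simp,
        Or.inr ⟨hGH, fun _ => hGH⟩⟩
    obtain ⟨G', hG', hle⟩ := hstep n hn G hG hDG hGH
    have hDG' : D ≤ G'.normalizedRadius α := by
      refine hDG.trans (le_trans (le_mul_of_one_le_right (hD.trans hDG) ?_) hle)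
      have : 0 ≤ c / ((n : ℝ) + 1) := by positivity
      linarith
    obtain ⟨m, ham, hmn, H, hH, hHle, hor⟩ := ih G' hG' hDG'
    refine ⟨m, ham, hmn.trans (Nat.le_succ n), H, hH, ?_, ?_⟩
    · rw [Finset.prod_Ico_succ_top hmn, mul_comm (∏ j ∈ _, _), ← mul_assoc]
      refine le_trans ?_ hHle
      gcongr
    · rcases hor with h | ⟨h, -⟩
      · exact Or.inl h
      · exact Or.inr ⟨h, fun h' => absurd h' (by omega)⟩

theorem deleteVertex_mem_Mon {ℱ : RGraphFamily r} (n : ℕ) (G : RGraph r (Fin (n + 1)))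
    (hG : G ∈ Mon ℱ (n + 1)) (k : Fin (n + 1)) : G.deleteVertex k ∈ Mon ℱ n :=
  Free.pullback hG k.succAboveEmb

/-- An `ℱ`-free graph of large normalized radius that is not in `ℌ` has, by degree-stability, a
vertex whose weight is a constant factor below the average; deleting it increases the normalized
radius. -/
theorem DegreeStable.exists_deleteVertex_ge {ℱ ℌ : RGraphFamily r} (hr : 2 ≤ r) (hα : 1 < α)
    (h : ℱ.DegreeStable ℌ) :
    ∃ c : ℝ, 0 < c ∧ ∃ N : ℕ, ∀ n ≥ N, ∀ G ∈ Mon ℱ (n + 1),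
      (Mon ℱ).edgeDensity ≤ G.normalizedRadius α → G ∉ ℌ (n + 1) →
      ∃ H ∈ Mon ℱ n, G.normalizedRadius α * (1 + c / ((n : ℝ) + 1)) ≤ H.normalizedRadius α := by
  have hα0 : 0 < α := by linarith
  obtain ⟨n₀, ε, hε, hstab⟩ := h.stable
  obtain ⟨η, hη, N, hN⟩ := exists_minDegree_ge hr hα h.density_pos.le hε
  have hκ : 0 < (r : ℝ) - max ((r : ℝ) / α) 1 := by
    have hr' : (2 : ℝ) ≤ r := by exact_mod_cast hr
    exact sub_pos.2 (max_lt (div_lt_self (by linarith) hα) (by linarith))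
  refine ⟨((r : ℝ) - max ((r : ℝ) / α) 1) * η, mul_pos hκ hη, max r (max n₀ N), ?_⟩
  intro n hn G hG hD hGH
  have hrn : r ≤ n := le_of_max_le_left hn
  have hn₀ : n₀ ≤ n + 1 :=
    (le_of_max_le_left (le_of_max_le_right hn)).trans (Nat.le_succ n)
  have hNn : N ≤ n + 1 :=
    (le_of_max_le_right (le_of_max_le_right hn)).trans (Nat.le_succ n)
  obtain ⟨x, hx⟩ := G.exists_isMaximizer hα0
  obtain ⟨k, hk⟩ : ∃ k, x k ^ α < (1 - η) / ((n + 1 : ℕ) : ℝ) := by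
    by_contra! hall
    exact hGH (hstab _ hn₀ G hG (hN _ hNn G x hx hD hall))
  have hpos : (0 : ℝ) < ((n + 1 : ℕ) : ℝ) := by positivity
  rw [sub_div] at hk
  have hη' : 0 < η / ((n + 1 : ℕ) : ℝ) := by positivity
  refine ⟨_, deleteVertex_mem_Mon n G hG k, le_trans ?_
    (hx.normalizedRadius_deleteVertex_ge (k := k) hr hα hrn (by linarith))⟩
  refine mul_le_mul_of_nonneg_left ?_ (normalizedRadius_nonneg hα0 (Nat.succ_ne_zero n) G)
  rw [mul_div_assoc]
  have : η / ((n : ℝ) + 1) ≤ 1 / ((n + 1 : ℕ) : ℝ) - x k ^ α := by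
    rw [show (n : ℝ) + 1 = ((n + 1 : ℕ) : ℝ) by push_cast; ring]
    linarith
  gcongr

theorem exists_normalizedRadius_le (α : ℝ) (r n : ℕ) :
    ∃ C : ℝ, ∀ G : RGraph r (Fin n), G.normalizedRadius α ≤ C := by
  obtain ⟨C, hC⟩ := (Set.finite_range fun G : RGraph r (Fin n) => G.normalizedRadius α).bddAbove
  exact ⟨C, fun G => hC ⟨G, rfl⟩⟩

/-- The descent from a large order cannot reach the order `a`, since the normalized radius would
exceed the bound for that order. -/
theorem exists_descent_mem {ℱ ℌ : RGraphFamily r} {c : ℝ} (hc : 0 < c)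
    (hD : 0 < (Mon ℱ).edgeDensity) {a : ℕ}
    (hstep : ∀ n ≥ a, ∀ G ∈ Mon ℱ (n + 1), (Mon ℱ).edgeDensity ≤ G.normalizedRadius α →
      G ∉ ℌ (n + 1) →
      ∃ H ∈ Mon ℱ n, G.normalizedRadius α * (1 + c / ((n : ℝ) + 1)) ≤ H.normalizedRadius α) :
    ∃ N : ℕ, ∀ n ≥ N, ∀ G ∈ Mon ℱ n, (Mon ℱ).edgeDensity ≤ G.normalizedRadius α →
      ∃ m, a ≤ m ∧ m ≤ n ∧ ∃ H ∈ ℌ m,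
        G.normalizedRadius α * ∏ j ∈ Finset.Ico m n, (1 + c / ((j : ℝ) + 1)) ≤
          H.normalizedRadius α ∧ (m = n → G ∈ ℌ n) := by
  obtain ⟨C, hC⟩ := exists_normalizedRadius_le α r a
  obtain ⟨N, hN⟩ := eventually_atTop.1
    ((tendsto_prod_Ico_one_add_atTop hc a).eventually_gt_atTop (C / (Mon ℱ).edgeDensity))
  refine ⟨max a N, fun n hn G hG hDG => ?_⟩
  obtain ⟨m, ham, hmn, H, hH, hle, hor⟩ :=
    exists_descent hc hD.le hstep (le_of_max_le_left hn) G hG hDG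
  rcases hor with rfl | ⟨hHH, hmn'⟩
  · have h1 := hN n (le_of_max_le_right hn)
    rw [div_lt_iff₀ hD] at h1
    have h2 : (∏ j ∈ Finset.Ico m n, (1 + c / ((j : ℝ) + 1))) * (Mon ℱ).edgeDensity ≤
        (∏ j ∈ Finset.Ico m n, (1 + c / ((j : ℝ) + 1))) * G.normalizedRadius α :=
      mul_le_mul_of_nonneg_left hDG (Finset.prod_nonneg fun j _ => by positivity)
    linarith [hC H]
  · exact ⟨m, ham, hmn, H, hHH, hle, hmn'⟩

/-- The normalized spectral extremal numbers of `Col P` are at least the edge density of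
`Mon ℱ`. -/
theorem DegreeStable.edgeDensity_le_normalizedEx {ℱ : RGraphFamily r} {P : Pattern r}
    (hr : 2 ≤ r) (hα : 1 < α) (h : ℱ.DegreeStable (Col P)) {n : ℕ} (hn : r ≤ n) :
    (Mon ℱ).edgeDensity ≤ (Col P).normalizedEx α n := by
  have hα0 : 0 < α := by linarith
  have hD := h.density_pos
  obtain ⟨c, hc, N, hstep⟩ := h.exists_deleteVertex_ge hr hα
  obtain ⟨N', hN'⟩ := exists_descent_mem (a := max N n) hc hD
    fun k hk => hstep k (le_of_max_le_left hk)
  -- The descent starts from an `ℱ`-free graph with the maximum number of edges.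
  set M := max N' r
  have hrM : r ≤ M := le_max_right _ _
  have hex := edgeDensity_le (deleteVertex_mem_Mon (ℱ := ℱ)) hrM
  obtain ⟨G, hG, hcard⟩ := exists_card_edges_eq_ex (𝒬 := Mon ℱ) (n := M) (by
    intro h0
    rw [h0, Nat.cast_zero, zero_div] at hex
    linarith)
  have hDG : (Mon ℱ).edgeDensity ≤ G.normalizedRadius α := by
    refine hex.trans ?_
    rw [← hcard]
    exact card_edges_div_choose_le_normalizedRadius hα0 (by omega) G
  obtain ⟨m, ham, hmM, H, hH, hle, -⟩ := hN' M (le_max_left _ _) G hG hDG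
  have hnm : n ≤ m := le_of_max_le_right ham
  have hanti : ∀ m, n ≤ m → (Col P).normalizedEx α m ≤ (Col P).normalizedEx α n := by
    intro m hm
    induction m, hm using Nat.le_induction with
    | base => exact le_rfl
    | succ m hm ih => exact (normalizedEx_Col_succ_le hr hα P (hn.trans hm)).trans ih
  refine le_trans ?_ (hanti m hnm)
  refine le_trans ?_ (normalizedRadius_le_normalizedEx (spectralRadius_le_spectralEx hH))
  refine hDG.trans (le_trans (le_mul_of_one_le_right (hD.le.trans hDG) ?_) hle)
  refine (Finset.prod_const_one (s := Finset.Ico m M)).symm.trans_le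
    (Finset.prod_le_prod (fun _ _ => zero_le_one) fun j _ => ?_)
  have : 0 ≤ c / ((j : ℝ) + 1) := by positivity
  linarith

/-- For large `n`, an `n`-vertex `ℱ`-free graph whose spectral radius is at least the maximum over
`Col P` is `P`-colorable. -/
theorem DegreeStable.colorable_of_spectralEx_le {ℱ : RGraphFamily r} {P : Pattern r}
    (hr : 2 ≤ r) (hα : 1 < α) (h : ℱ.DegreeStable (Col P)) :
    ∃ N : ℕ, ∀ n ≥ N, ∀ G ∈ Mon ℱ n,
      (Col P).spectralEx α n ≤ G.spectralRadius α → G ∈ Col P n := by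
  have hD := h.density_pos
  obtain ⟨c, hc, N₁, hstep⟩ := h.exists_deleteVertex_ge hr hα
  obtain ⟨J, hJ⟩ := eventually_one_lt_mul hc (r : ℝ)
  set a := max N₁ (max J (r + 1))
  have haJ : J ≤ a := (le_max_left _ _).trans (le_max_right _ _)
  have har : r + 1 ≤ a := (le_max_right _ _).trans (le_max_right _ _)
  obtain ⟨N, hN⟩ := exists_descent_mem (a := a) hc hD
    fun k hk => hstep k (le_of_max_le_left hk)
  refine ⟨max N r, fun n hn G hG hle => ?_⟩
  have hle := normalizedEx_le_normalizedRadius hle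
  have hDn := h.edgeDensity_le_normalizedEx hr hα (le_of_max_le_right hn)
  obtain ⟨m, ham, hmn, H, hH, hGH, himp⟩ := hN n (le_of_max_le_left hn) G hG (hDn.trans hle)
  rcases hmn.eq_or_lt with hmn' | hmn'
  · exact himp hmn'
  exfalso
  have hHm : H.normalizedRadius α ≤ (Col P).normalizedEx α m :=
    normalizedRadius_le_normalizedEx (spectralRadius_le_spectralEx hH)
  have hDm := h.edgeDensity_le_normalizedEx (n := m) hr hα (by omega)
  have hclone := normalizedEx_Col_mul_prod_le hr hα P (by omega : r ≤ m) hmn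
  set b := (Col P).normalizedEx α
  set A := ∏ j ∈ Finset.Ico m n, (1 + c / ((j : ℝ) + 1)) with hA
  set B := ∏ j ∈ Finset.Ico m n, (1 - (r : ℝ) ^ 2 / (j : ℝ) ^ 2) with hB
  have hA0 : 0 ≤ A := Finset.prod_nonneg fun j _ => by positivity
  have hAB : 1 < A * B := by
    rw [hA, hB, ← Finset.prod_mul_distrib]
    refine (Finset.prod_const_one (s := Finset.Ico m n)).symm.trans_lt
      (Finset.prod_lt_prod_of_nonempty (fun _ _ => one_pos) (fun j hj => ?_)
        (Finset.nonempty_Ico.2 hmn'))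
    exact hJ j (haJ.trans (ham.trans (Finset.mem_Ico.1 hj).1))
  have h1 : b n * A ≤ b m := (mul_le_mul_of_nonneg_right hle hA0).trans (hGH.trans hHm)
  have h2 : b m * (A * B) ≤ b m := by
    calc b m * (A * B) = b m * B * A := by ring
      _ ≤ b n * A := mul_le_mul_of_nonneg_right hclone hA0
      _ ≤ b m := h1
  have hbm : 0 < b m := hD.trans_le hDm
  nlinarith

end RGraphFamily

theorem mainTheorem1 (α : ℝ) (hα : 1 < α) (r : ℕ) (hr : 2 ≤ r) (P : Pattern r)
    (ℱ : RGraphFamily r) (hiso : ℱ.NoIsolatedVertices)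
    (hstab : ℱ.DegreeStable (RGraphFamily.Col P)) :
    ∃ N : ℕ, ∀ n ≥ N,
      (∀ G : RGraph r (Fin n), G.Free ℱ →
        G.spectralRadius α ≤ (RGraphFamily.Col P).spectralEx α n ∧
        (G.spectralRadius α = (RGraphFamily.Col P).spectralEx α n → G.Colorable P)) ∧
      ℱ.Mon.spectralEx α n = (RGraphFamily.Col P).spectralEx α n := by
  obtain ⟨N, hN⟩ := hstab.colorable_of_spectralEx_le hr hα
  refine ⟨N, fun n hn => ?_⟩
  have hle : ∀ G : RGraph r (Fin n), G.Free ℱ →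
      G.spectralRadius α ≤ (RGraphFamily.Col P).spectralEx α n := fun G hG => by
    by_contra! hlt
    exact hlt.not_ge (RGraphFamily.spectralRadius_le_spectralEx (hN n hn G hG hlt.le))
  refine ⟨fun G hG => ⟨hle G hG, fun h => hN n hn G hG h.ge⟩, ?_⟩
  obtain ⟨H, hH, hHeq⟩ := RGraphFamily.exists_spectralRadius_eq_spectralEx (α := α)
    (RGraphFamily.Col_nonempty P n)
  have hHM : H ∈ ℱ.Mon n := hstab.free n hH
  refine le_antisymm (csSup_le ⟨_, H, hHM, rfl⟩ ?_) ?_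
  · rintro _ ⟨G, hG, rfl⟩
    exact hle G hG
  · rw [← hHeq]
    exact RGraphFamily.spectralRadius_le_spectralEx hHM
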